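/- **Setting.** Let $G$ be a compact Abelian Lie group of dimension $D$ with an invariant Riemannian metric and normalized Haar measure, and let $K_\alpha=\sum_{\chi\in\widehat G}e^{-\alpha\lambda_\chi}\chi$ be its heat kernel at time $\alpha$ ($\lambda_\chi$ is the eigenvalue of $-\Delta$ on the character $\chi$). Fix a rank $d\ge 3$, a mass $m>0$ and a number $M>1$. A Feynman graph $\mathcal G$ has white and black nodes (the fields $\varphi,\overline\varphi$); for each colour $\ell=1,\dots,d$ each node lies on exactly one edge of colour $\ell$, joining a white node to a black one (the bubbles are the connected components under these edges); and its $L(\mathcal G)$ lines (edges of colour $0$) join white to black nodes, at most one line at each node. A node without a line carries an external leg. A face of colour $\ell$ is a maximal connected set of edges of colours $0$ and $\ell$ containing at least one line; it is closed if it is a circuit and open otherwise. For an orientation of lines and faces, $\epsilon_{ef}=\pm1$ if the face $f$ passes through the line $e$ with the same/opposite orientation, and $\epsilon_{ef}=0$ if it does not pass through $e$. A subgraph $\mathcal H$ is a set of $L(\mathcal H)$ lines; its internal faces are the $F(\mathcal H)$ closed faces of $\mathcal G$ passing only through lines of $\mathcal H$; $R(\mathcal H)$ is the rank of $(\epsilon_{ef})$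 restricted to lines and internal faces of $\mathcal H$, and $$\omega(\mathcal H)=-2L(\mathcal H)+D\,\bigl(F(\mathcal H)-R(\mathcal H)\bigr).$$ The face-connected components of $\mathcal H$ are the classes of its lines under the equivalence relation generated by sharing an internal face of $\mathcal H$. For a scale attribution $\mu=(i_e)_e$, $i_e\in\mathbb N$, let $\mathcal G_i$ be the set of lines with $i_e\ge i$, with face-connected components $\mathcal G_i^{(k)}$, $1\le k\le k(i)$ (the high subgraphs). With $I_0=[1,\infty)$, $I_i=[M^{-2i},M^{-2(i-1)}]$ for $i\ge1$, and $\alpha(f)=\sum_{e\in f}\alpha_e$, the sliced amplitude is $$\mathcal A_{\mathcal G,\mu}(g)=\Bigl[\prod_e\int_{I_{i_e}}d\alpha_e\,e^{-m^2\alpha_e}\int_G dh_e\Bigr]\prod_{f\text{ closed}}K_{\alpha(f)}\Bigl(\prod_{e\in f}h_e^{\epsilon_{ef}}\Bigr)\prod_{f\text{ open}}K_{\alpha(f)}\Bigl(g_{s(f)}\prod_{e\in f}h_e^{\epsilon_{ef}}\,g_{t(f)}^{-1}\Bigr),$$ a function of the boundary variables $g=(g_{s(f)},g_{t(f)})_{f\text{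 open}}$ (a number if there is no open face); the amputated amplitude $\mathcal A^{\rm amp}_{\mathcal G,\mu}$ is the same integral without the factors of the open faces. **Proposition (Abelian power-counting).** There is a constant $K>0$, depending only on $G$ (with its metric), $d$, $m$, $M$, such that for every Feynman graph $\mathcal G$, every orientation and every scale attribution $\mu$: the integral defining $\mathcal A_{\mathcal G,\mu}(g)$ converges absolutely for every $g$, the function $\mathcal A_{\mathcal G,\mu}$ is integrable in $g$, the integral defining $\mathcal A^{\rm amp}_{\mathcal G,\mu}$ converges absolutely, and $$\int|\mathcal A_{\mathcal G,\mu}(g)|\,dg\ \le\ K^{L(\mathcal G)}\prod_{i\in\mathbb N}\ \prod_{k=1}^{k(i)}M^{\omega(\mathcal G_i^{(k)})},\qquad |\mathcal A^{\rm amp}_{\mathcal G,\mu}|\ \le\ K^{L(\mathcal G)}\prod_{i\in\mathbb N}\ \prod_{k=1}^{k(i)}M^{\omega(\mathcal G_i^{(k)})}.$$ In particular, if $\mathcal G$ has no open face, the number $|\mathcal A_{\mathcal G,\mu}|$ is bounded by the right-hand side; in general $\bigl|\int\mathcal A_{\mathcal G,\mu}\,\phi\bigr|$ is bounded by $\|\phi\|_\infty$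 times the right-hand side for every bounded measurable function $\phi$ of the boundary variables. -/

import Mathlib

open MeasureTheory
open scoped Manifold ContDiff

/-! ### Feynman graphs of a rank-`d` tensorial field theory, and their faces -/

/-- A Feynman graph of a rank-`d` tensorial group field theory, given by its `(d+1)`-coloured
extension. The white (resp. black) nodes are the fields `φ` (resp. `φ̄`) of the interaction
vertices. For each colour `ℓ = 1, …, d` every white node is joined to exactly one black node
by an edge of colour `ℓ`; the bubbles (interaction vertices) are the connected components of the
nodes under these edges. A line (edge of colour `0`, carrying a propagator) joins a white node to
a black node, and a node belongs to at most one line; the nodes that belong to no line carry the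
external legs. -/
structure FeynmanGraph (d : ℕ) where
  /-- the nodes `φ` -/
  White : Type
  /-- the nodes `φ̄` -/
  Black : Type
  /-- the internal lines (edges of colour `0`) -/
  Line : Type
  [finWhite : Finite White]
  [finBlack : Finite Black]
  [finLine : Fintype Line]
  /-- the edges of colour `ℓ` inside the bubbles -/
  edge : Fin d → White ≃ Black
  /-- the white end of a line -/
  white : Line ↪ White
  /-- the black end of a line -/
  black : Line ↪ Black

namespace FeynmanGraph

attribute [instance] FeynmanGraph.finWhite FeynmanGraph.finBlack FeynmanGraph.finLine

variable {d : ℕ} (Γ : FeynmanGraph d)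

/-- Going along the line `e` from its white to its black end and then along the edge of
colour `ℓ`, one arrives at the white end of the line `e'`. -/
def Next (ℓ : Fin d) (e e' : Γ.Line) : Prop :=
  Γ.white e' = (Γ.edge ℓ).symm (Γ.black e)

/-- Two lines lie on the same face of colour `ℓ`: they are connected through edges of
colours `0` and `ℓ`. -/
def faceSetoid (ℓ : Fin d) : Setoid Γ.Line :=
  Relation.EqvGen.setoid (Γ.Next ℓ)

/-- The faces: a face of colour `ℓ` is a maximal connected set of edges of colours `0` and `ℓ`
(containing at least one line), recorded through the lines it passes through. -/
def Face : Type := Σ ℓ : Fin d, Quotient (Γ.faceSetoid ℓ)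

instance : Finite Γ.Face :=
  inferInstanceAs (Finite (Σ ℓ : Fin d, Quotient (Γ.faceSetoid ℓ)))

noncomputable instance : Fintype Γ.Face := Fintype.ofFinite _

variable {Γ}

/-- The face `f` passes through the line `e`. -/
def Face.Through (f : Γ.Face) (e : Γ.Line) : Prop :=
  Quotient.mk (Γ.faceSetoid f.1) e = f.2

/-- A face is closed if it is a circuit: each of its lines is followed by another (possibly the
same) line. Otherwise it is open, and ends on external legs on both sides. -/
def Face.Closed (f : Γ.Face) : Prop :=
  ∀ e, f.Through e → ∃ e', Γ.Next f.1 e e'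

variable (Γ)

/-- The closed (internal) faces of the graph. -/
abbrev ClosedFace : Type := {f : Γ.Face // f.Closed}

/-- The open (external) faces of the graph. -/
abbrev OpenFace : Type := {f : Γ.Face // ¬ f.Closed}

noncomputable instance : Fintype Γ.ClosedFace := Fintype.ofFinite _

noncomputable instance : Fintype Γ.OpenFace := Fintype.ofFinite _

/-- An orientation of the lines and faces. A line has sign `+1` if it is oriented from its white
to its black end; a face has sign `+1` if it is oriented so as to run through its lines
from white to black ends (every face runs through all its lines in the same such sense). -/
structure Orientation where
  /-- the signs of the lines -/
  line : Γ.Line → ℤˣ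
  /-- the signs of the faces -/
  face : Γ.Face → ℤˣ

variable {Γ}

open Classical in
/-- The incidence number `ε_{ef}`: `+1` if the face `f` runs through the line `e` with the same
orientation, `-1` if it runs through `e` with the opposite orientation, `0` otherwise. -/
noncomputable def incidence (o : Γ.Orientation) (e : Γ.Line) (f : Γ.Face) : ℤ :=
  if f.Through e then (o.line e : ℤ) * (o.face f : ℤ) else 0

/-! ### Subgraphs, face-connected components, degree of divergence -/

open Classical in
/-- The internal faces of a subgraph `H` (a set of lines): the closed faces that pass only
through lines of `H`. -/
noncomputable def internalFaces (H : Finset Γ.Line) : Finset Γ.Face :=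
  {f | f.Closed ∧ ∀ e, f.Through e → e ∈ H}

/-- The rank `R(H)` of the incidence matrix of the lines and internal faces of `H`. -/
noncomputable def incidenceRank (o : Γ.Orientation) (H : Finset Γ.Line) : ℕ :=
  (Matrix.of fun (e : {e // e ∈ H}) (f : {f // f ∈ internalFaces H}) =>
    (incidence o e.1 f.1 : ℚ)).rank

/-- The Abelian degree of divergence `ω(H) = -2 L(H) + D (F(H) - R(H))`. -/
noncomputable def divergenceDegree (D : ℕ) (o : Γ.Orientation) (H : Finset Γ.Line) : ℤ :=
  -2 * (H.card : ℤ) + (D : ℤ) * (((internalFaces H).card : ℤ) - (incidenceRank o H : ℤ))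

/-- Two lines of `H` share an internal face of `H`. -/
def ShareFace (H : Finset Γ.Line) (e e' : Γ.Line) : Prop :=
  ∃ f ∈ internalFaces H, f.Through e ∧ f.Through e'

open Classical in
/-- The face-connected components of `H`: the sets of lines of the maximal
factorized blocks of the incidence matrix of `H`. A line of `H` without internal face of `H` forms
a component by itself. -/
noncomputable def faceComponents (H : Finset Γ.Line) : Finset (Finset Γ.Line) :=
  H.image fun e => H.filter fun e' => Relation.EqvGen (ShareFace H) e e'

/-- The subgraph `Γ_i` of the lines of scale at least `i`; its face-connected components
are the high subgraphs `Γ_i^{(k)}`. -/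
def linesAbove (μ : Γ.Line → ℕ) (i : ℕ) : Finset Γ.Line :=
  Finset.univ.filter fun e => i ≤ μ e

end FeynmanGraph

/-! ### The heat kernel on a compact Abelian Lie group -/

section HeatKernel

variable (E : Type*) [NormedAddCommGroup E] [InnerProductSpace ℝ E]
  {G : Type*} [TopologicalSpace G] [ChartedSpace E G] [CommGroup G]

/-- The (unitary) characters of the Abelian Lie group `G`. Continuous characters of
a Lie group are automatically smooth. -/
abbrev LieCharacter (G : Type*) [TopologicalSpace G] [ChartedSpace E G] [CommGroup G] : Type _ :=
  ContMDiffMonoidMorphism 𝓘(ℝ, E) (𝓡 1) ∞ G Circle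

variable {E}

/-- The differential at the identity of the character `χ`, as a linear map on `T₁G = E`. -/
noncomputable def characterDifferential (χ : LieCharacter E G) : E →L[ℝ] ℂ :=
  mfderiv 𝓘(ℝ, E) 𝓘(ℝ, ℂ) (fun g : G => ((χ g : Circle) : ℂ)) 1

/-- The eigenvalue of `-Δ` on the character `χ`, where `Δ` is the Laplace–Beltrami operator of
the invariant Riemannian metric on `G` whose value on the tangent space `T₁G = E` is the inner
product of `E`. Since `χ` is a homomorphism, `-Δχ = |d₁χ|² χ`. -/
noncomputable def laplaceEigenvalue (χ : LieCharacter E G) : ℝ :=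
  ‖characterDifferential χ‖ ^ 2

variable (E)

/-- The heat kernel `K_α(g)` of `G` at time `α`, with respect to the normalized Haar measure:
the kernel of the convolution operator `e^{αΔ}`, in its spectral form. -/
noncomputable def heatKernel (α : ℝ) (g : G) : ℂ :=
  ∑' χ : LieCharacter E G,
    (Real.exp (-(α * laplaceEigenvalue χ)) : ℂ) * ((χ g : Circle) : ℂ)

end HeatKernel

/-! ### Sliced amplitudes -/

/-- The `i`-th slice of the Schwinger parameter: `[1, ∞)` for `i = 0`, and
`[M^{-2i}, M^{-2(i-1)}]` for `i ≥ 1`. -/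
def scaleSlice (M : ℝ) : ℕ → Set ℝ
  | 0 => Set.Ici 1
  | i + 1 => Set.Icc ((M ^ (2 * (i + 1)))⁻¹) ((M ^ (2 * i))⁻¹)

namespace FeynmanGraph

variable {d : ℕ} {Γ : FeynmanGraph d}

open Classical in
/-- `α(f)`, the sum of the Schwinger parameters of the lines of the face `f`. -/
noncomputable def faceParameter (α : Γ.Line → ℝ) (f : Γ.Face) : ℝ :=
  ∑ e with f.Through e, α e

section Amplitude

variable (E : Type*) [NormedAddCommGroup E] [InnerProductSpace ℝ E]
  {G : Type*} [TopologicalSpace G] [ChartedSpace E G] [CommGroup G]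

/-- The holonomy `∏_{e ∈ f} h_e^{ε_{ef}}` along the face `f`. -/
noncomputable def holonomy (o : Γ.Orientation) (h : Γ.Line → G) (f : Γ.Face) : G :=
  ∏ e, h e ^ incidence o e f

/-- The amputated integrand: `∏_e e^{-m² α_e} ∏_f K_{α(f)}(∏_{e ∈ f} h_e^{ε_{ef}})`
over lines and closed faces. -/
noncomputable def amputatedIntegrand (o : Γ.Orientation) (m : ℝ)
    (x : (Γ.Line → ℝ) × (Γ.Line → G)) : ℂ :=
  (∏ e, (Real.exp (-(m ^ 2 * x.1 e)) : ℂ)) *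
    ∏ f : Γ.ClosedFace, heatKernel E (faceParameter x.1 f.1) (holonomy o x.2 f.1)

/-- The full integrand, with the factors
`K_{α(f)}(g_{s(f)} (∏_{e ∈ f} h_e^{ε_{ef}}) g_{t(f)}⁻¹)` of the open faces, where
`b f = (g_{s(f)}, g_{t(f)})` are the boundary variables. -/
noncomputable def integrand (o : Γ.Orientation) (m : ℝ) (b : Γ.OpenFace → G × G)
    (x : (Γ.Line → ℝ) × (Γ.Line → G)) : ℂ :=
  amputatedIntegrand E o m x *
    ∏ f : Γ.OpenFace,
      heatKernel E (faceParameter x.1 f.1) ((b f).1 * holonomy o x.2 f.1 * (b f).2⁻¹)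

variable [MeasurableSpace G]

/-- The measure `∏_e dα_e dh_e`, each `α_e` being restricted to the slice of scale `μ e`. -/
noncomputable def slicedMeasure (ν : Measure G) (M : ℝ) (μ : Γ.Line → ℕ) :
    Measure ((Γ.Line → ℝ) × (Γ.Line → G)) :=
  (Measure.pi fun e => (volume : Measure ℝ).restrict (scaleSlice M (μ e))).prod
    (Measure.pi fun _ => ν)

/-- The sliced amplitude, as a function of the boundary variables of the open faces
(a number if there are none). -/
noncomputable def slicedAmplitude (ν : Measure G) (o : Γ.Orientation) (m M : ℝ)
    (μ : Γ.Line → ℕ) (b : Γ.OpenFace → G × G) : ℂ :=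
  ∫ x, integrand E o m b x ∂(slicedMeasure ν M μ)

/-- The amputated sliced amplitude, in which the contributions of the open faces are discarded. -/
noncomputable def amputatedAmplitude (ν : Measure G) (o : Γ.Orientation) (m M : ℝ)
    (μ : Γ.Line → ℕ) : ℂ :=
  ∫ x, amputatedIntegrand E o m x ∂(slicedMeasure ν M μ)

end Amplitude

/-- The product `∏_{i ∈ ℕ} ∏_k M^{ω(Γ_i^{(k)})}` over all nodes of the Gallavotti–Nicolò tree.
Only finitely many `i` contribute. -/
noncomputable def powerCounting (D : ℕ) (o : Γ.Orientation) (M : ℝ) (μ : Γ.Line → ℕ) : ℝ :=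
  ∏ᶠ i : ℕ, ∏ H ∈ faceComponents (linesAbove μ i), M ^ divergenceDegree D o H

end FeynmanGraph

/-! ### The character group of a Lie group -/

/-! Absolute values reduce everything to the amputated integrand. The heat kernel is non-negative
with integral one (`heatKernel_re_nonneg`, `integral_norm_heatKernel`), so each open face integrates
to one over its own pair of boundary variables.

For closed faces two estimates compete. Let i(f) be the lowest scale of a line of the face f. The
uniform bound on its kernel is C M^{D i(f)} (`exists_norm_heatKernel_le`). For a family S of faces
with linearly independent incidence columns, integrating over the group does better. After expansion
into characters, Haar integration keeps only the tuples that cancel along every line, and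
independence forces all their frequencies to vanish (`frequency_eq_zero_of_prod_eq_one`). Finitely
many characters have frequency zero, so a face of S costs a constant instead of M^{D i(f)}
(`lintegral_prod_heatKernel_le`).

The family S must be optimal at all scales simultaneously. Extending a basis from the highest scales
downwards (`exists_linearIndepOn_adapted`) gives an S whose trace on each Γ_i spans the columns of
Γ_i. A face internal to Γ_i but not to a component C has zero incidence with the lines of C. Hence S
contains at least R(C) internal faces of C, and at most F(C) - R(C) of them pay the uniform bound. A
line of scale i contributes a slice of length of order M^{-2i}. Spreading these powers of M over the
scales below i produces the product over high subgraphs (`le_powerCounting`).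

On the analytic side, a character is governed by its frequency, a vector of T₁G. Orthogonality and a
Lipschitz bound near the identity show that frequencies do not accumulate, so the heat trace is
comparable to a Gaussian integral. Positivity comes from writing the heat semigroup as a Gaussian
average. -/

section CharacterGroup

variable {E : Type*} [NormedAddCommGroup E] [InnerProductSpace ℝ E]
  {G : Type*} [TopologicalSpace G] [ChartedSpace E G] [CommGroup G]

namespace LieCharacter

theorem ext {χ ψ : LieCharacter E G} (h : ∀ g, χ g = ψ g) : χ = ψ := DFunLike.ext _ _ h

theorem contMDiff (χ : LieCharacter E G) : ContMDiff 𝓘(ℝ, E) (𝓡 1) ∞ (χ : G → Circle) :=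
  χ.contMDiff_toFun

noncomputable instance : Mul (LieCharacter E G) :=
  ⟨fun χ ψ => { toMonoidHom := χ.toMonoidHom * ψ.toMonoidHom
                contMDiff_toFun := χ.contMDiff.mul ψ.contMDiff }⟩

noncomputable instance : Inv (LieCharacter E G) :=
  ⟨fun χ => { toMonoidHom := χ.toMonoidHom⁻¹
              contMDiff_toFun := χ.contMDiff.inv }⟩

@[simp] theorem mul_apply (χ ψ : LieCharacter E G) (g : G) : (χ * ψ) g = χ g * ψ g := rfl
@[simp] theorem inv_apply (χ : LieCharacter E G) (g : G) : χ⁻¹ g = (χ g)⁻¹ := rfl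
@[simp] theorem one_apply (g : G) : (1 : LieCharacter E G) g = 1 := rfl

noncomputable instance : CommGroup (LieCharacter E G) :=
  { Group.ofLeftAxioms (G := LieCharacter E G) (fun a b c => ext fun g => by simp [mul_assoc])
      (fun a => ext fun g => by simp) (fun a => ext fun g => by simp) with
    mul_comm := fun a b => ext fun g => by simp [mul_comm] }

variable (G) in
/-- Evaluation of characters at a point, as a homomorphism. -/
noncomputable def evalHom (g : G) : LieCharacter E G →* Circle where
  toFun χ := χ g
  map_one' := rfl
  map_mul' _ _ := rfl

@[simp] theorem zpow_apply (χ : LieCharacter E G) (n : ℤ) (g : G) : (χ ^ n) g = χ g ^ n :=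
  map_zpow (evalHom G g) χ n

@[simp] theorem prod_apply {ι : Type*} (s : Finset ι) (χ : ι → LieCharacter E G) (g : G) :
    (∏ i ∈ s, χ i) g = ∏ i ∈ s, χ i g :=
  map_prod (evalHom G g) χ s

/-- The complex-valued function underlying a character is smooth. -/
theorem contMDiff_coe (χ : LieCharacter E G) :
    ContMDiff 𝓘(ℝ, E) 𝓘(ℝ, ℂ) ∞ (fun g : G => ((χ g : Circle) : ℂ)) := by
  have := finrank_real_complex_fact'
  exact (contMDiff_coe_sphere (E := ℂ) (n := 1)).comp χ.contMDiff

theorem continuous_coe (χ : LieCharacter E G) :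
    Continuous (fun g : G => ((χ g : Circle) : ℂ)) :=
  χ.contMDiff_coe.continuous

end LieCharacter

/-- The inverse of the chart at the identity, recentred at the origin. -/
noncomputable def chartExp (E : Type*) [NormedAddCommGroup E] [InnerProductSpace ℝ E]
    {G : Type*} [TopologicalSpace G] [ChartedSpace E G] [CommGroup G] (x : E) : G :=
  (extChartAt 𝓘(ℝ, E) (1 : G)).symm (extChartAt 𝓘(ℝ, E) (1 : G) 1 + x)

@[simp] theorem chartExp_zero : chartExp E (0 : E) = (1 : G) := by
  simp [chartExp]

/-- The manifold derivative at the identity is by definition the derivative in the chart; recentring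
the chart at the origin turns it into an ordinary derivative on `E`. -/
theorem LieCharacter.hasFDerivAt_chartExp (χ : LieCharacter E G) :
    HasFDerivAt (fun x : E => ((χ (chartExp E x) : Circle) : ℂ)) (characterDifferential χ) 0 := by
  have h : MDifferentiableAt 𝓘(ℝ, E) 𝓘(ℝ, ℂ) (fun g : G => ((χ g : Circle) : ℂ)) 1 :=
    (χ.contMDiff_coe 1).mdifferentiableAt (by simp)
  have h2 := h.hasMFDerivAt.2
  simp only [ModelWithCorners.range_eq_univ] at h2
  have h3 : HasFDerivAt (fun x : E => extChartAt 𝓘(ℝ, E) (1 : G) 1 + x)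
      (ContinuousLinearMap.id ℝ E) 0 := (hasFDerivAt_id (𝕜 := ℝ) (0 : E)).const_add _
  have h4 : HasFDerivAt (writtenInExtChartAt 𝓘(ℝ, E) 𝓘(ℝ, ℂ) 1 (fun g : G => ((χ g : Circle) : ℂ)))
      (characterDifferential χ) (extChartAt 𝓘(ℝ, E) (1 : G) 1 + 0) := by
    rw [add_zero]; exact hasFDerivWithinAt_univ.1 h2
  have := h4.comp (0 : E) h3
  rw [ContinuousLinearMap.comp_id] at this
  exact this

/-- Leibniz rule at the identity, where both characters equal one. -/
theorem characterDifferential_mul (χ ψ : LieCharacter E G) :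
    characterDifferential (χ * ψ) = characterDifferential χ + characterDifferential ψ := by
  have h := (χ.hasFDerivAt_chartExp).mul (ψ.hasFDerivAt_chartExp)
  have h' := (χ * ψ).hasFDerivAt_chartExp
  have h2 : HasFDerivAt (fun x : E => (((χ * ψ) (chartExp E x) : Circle) : ℂ)) _ 0 := h
  rw [h'.unique h2]
  simp [add_comm]

/-- The powers of chart points along a ray evaluate a character at the exponential map. -/
theorem LieCharacter.tendsto_chartExp_pow (χ : LieCharacter E G) (x : E) :
    Filter.Tendsto (fun n : ℕ => ((χ (chartExp E ((n : ℝ)⁻¹ • x) ^ n) : Circle) : ℂ)) Filter.atTop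
      (nhds (Complex.exp (characterDifferential χ x))) := by
  have h1 : HasDerivAt (fun t : ℝ => ((χ (chartExp E (t • x)) : Circle) : ℂ))
      (characterDifferential χ x) 0 := by
    have h2 : HasDerivAt (fun t : ℝ => t • x) x 0 := by
      simpa using (hasDerivAt_id (0 : ℝ)).smul_const x
    have h3 : HasFDerivAt (fun x : E => ((χ (chartExp E x) : Circle) : ℂ))
        (characterDifferential χ) ((0 : ℝ) • x) := by
      rw [zero_smul]; exact χ.hasFDerivAt_chartExp
    exact h3.comp_hasDerivAt (0 : ℝ) h2
  have h4 := Complex.tendsto_one_add_pow_exp_of_tendsto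
    (g := fun n : ℕ => ((χ (chartExp E ((n : ℝ)⁻¹ • x)) : Circle) : ℂ) - 1)
    (t := characterDifferential χ x) (by
      have h5 := h1.tendsto_slope_zero_right
      have h6 : Filter.Tendsto (fun n : ℕ => ((n : ℝ))⁻¹) Filter.atTop (nhdsWithin 0 (Set.Ioi 0)) :=
        tendsto_inv_atTop_nhdsGT_zero.comp tendsto_natCast_atTop_atTop
      refine (h5.comp h6).congr fun n => ?_
      simp)
  refine h4.congr fun n => ?_
  simp

/-- The exponential of the differential is a limit of unit complex numbers, so it has modulus one.
-/
theorem characterDifferential_re (χ : LieCharacter E G) (x : E) :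
    (characterDifferential χ x).re = 0 := by
  have h := (χ.tendsto_chartExp_pow x).norm
  simp only [Circle.norm_coe] at h
  have := tendsto_nhds_unique h tendsto_const_nhds
  rw [Complex.norm_exp] at this
  exact Real.exp_eq_one_iff _ |>.1 this

end CharacterGroup

/-! ### Frequencies of characters as vectors of the Lie algebra. -/

section Frequency

variable {E : Type*} [NormedAddCommGroup E] [InnerProductSpace ℝ E] [FiniteDimensional ℝ E]
  {G : Type*} [TopologicalSpace G] [ChartedSpace E G] [CommGroup G]

open scoped RealInnerProductSpace

/-- The frequency of a character: the vector representing the imaginary part of its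
differential at the identity. -/
noncomputable def frequency (χ : LieCharacter E G) : E :=
  (InnerProductSpace.toDual ℝ E).symm (Complex.imCLM.comp (characterDifferential χ))

theorem characterDifferential_apply (χ : LieCharacter E G) (x : E) :
    characterDifferential χ x = (⟪frequency χ, x⟫ : ℝ) * Complex.I := by
  apply Complex.ext
  · simp [characterDifferential_re]
  · simp [frequency]

theorem frequency_mul (χ ψ : LieCharacter E G) :
    frequency (χ * ψ) = frequency χ + frequency ψ := by
  simp [frequency, characterDifferential_mul, ContinuousLinearMap.comp_add]

/-- The frequency as a homomorphism. -/
noncomputable def frequencyHom : LieCharacter E G →* Multiplicative E :=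
  MonoidHom.mk' (fun χ => Multiplicative.ofAdd (frequency χ)) fun χ ψ => by
    rw [frequency_mul]; rfl

theorem frequency_one : frequency (1 : LieCharacter E G) = 0 :=
  congrArg Multiplicative.toAdd (map_one (frequencyHom (E := E) (G := G)))

theorem frequency_inv (χ : LieCharacter E G) : frequency χ⁻¹ = -frequency χ :=
  congrArg Multiplicative.toAdd (map_inv frequencyHom χ)

theorem frequency_zpow (χ : LieCharacter E G) (n : ℤ) : frequency (χ ^ n) = n • frequency χ :=
  congrArg Multiplicative.toAdd (map_zpow frequencyHom χ n)

theorem frequency_prod {ι : Type*} (s : Finset ι) (χ : ι → LieCharacter E G) :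
    frequency (∏ i ∈ s, χ i) = ∑ i ∈ s, frequency (χ i) := by
  have := congrArg Multiplicative.toAdd (map_prod frequencyHom χ s)
  rw [toAdd_prod] at this
  exact this

theorem norm_characterDifferential (χ : LieCharacter E G) :
    ‖characterDifferential χ‖ = ‖frequency χ‖ := by
  rw [frequency, LinearIsometryEquiv.norm_map]
  have h (x : E) : ‖characterDifferential χ x‖ = ‖Complex.imCLM (characterDifferential χ x)‖ := by
    rw [characterDifferential_apply]
    simp
  apply le_antisymm
  · refine ContinuousLinearMap.opNorm_le_bound _ (norm_nonneg _) fun x => ?_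
    rw [h]
    exact (Complex.imCLM.comp (characterDifferential χ)).le_opNorm x
  · refine ContinuousLinearMap.opNorm_le_bound _ (norm_nonneg _) fun x => ?_
    rw [ContinuousLinearMap.comp_apply, ← h]
    exact (characterDifferential χ).le_opNorm x

theorem laplaceEigenvalue_eq (χ : LieCharacter E G) :
    laplaceEigenvalue χ = ‖frequency χ‖ ^ 2 := by
  rw [laplaceEigenvalue, norm_characterDifferential]

end Frequency

/-! ### Uniform Lipschitz bounds for characters near the identity. -/

section Lipschitz

variable (E : Type*) [NormedAddCommGroup E] [InnerProductSpace ℝ E] [FiniteDimensional ℝ E]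
  (G : Type*) [TopologicalSpace G] [ChartedSpace E G] [CommGroup G] [LieGroup 𝓘(ℝ, E) ∞ G]

/-- Near the identity, quotients of chart points are chart points of Lipschitz size. -/
theorem exists_chartExp_div :
    ∃ C r : ℝ, 0 < C ∧ 0 < r ∧ ∀ x y : E, ‖x‖ < r → ‖y‖ < r →
      ∃ z : E, ‖z‖ ≤ C * ‖x - y‖ ∧ (chartExp E x : G)⁻¹ * chartExp E y = chartExp E z := by
  set φ := extChartAt 𝓘(ℝ, E) (1 : G) with hφ
  have := ‹LieGroup 𝓘(ℝ, E) ∞ G›.toIsManifold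
  have hc : ContMDiffAt 𝓘(ℝ, E) 𝓘(ℝ, E) ∞ (chartExp E : E → G) 0 := by
    have h1 : ContMDiffAt 𝓘(ℝ, E) 𝓘(ℝ, E) ∞ φ.symm (φ 1 + 0) := by
      rw [add_zero]
      exact (contMDiffOn_extChartAt_symm (1 : G)).contMDiffAt (extChartAt_target_mem_nhds 1)
    have h2 : ContMDiffAt 𝓘(ℝ, E) 𝓘(ℝ, E) ∞ (fun x : E => φ 1 + x) 0 :=
      (contDiff_const.add contDiff_id).contMDiff.contMDiffAt
    exact h1.comp (0 : E) h2
  have hm : ContMDiffAt 𝓘(ℝ, E × E) 𝓘(ℝ, E) ∞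
      (fun p : E × E => (chartExp E p.1 : G)⁻¹ * chartExp E p.2) (0, 0) := by
    have h1 : ContMDiffAt 𝓘(ℝ, E × E) 𝓘(ℝ, E) ∞ (fun p : E × E => (chartExp E p.1 : G)) (0, 0) :=
      ContMDiffAt.comp (0, 0) (g := (chartExp E : E → G)) hc contDiff_fst.contMDiff.contMDiffAt
    have h2 : ContMDiffAt 𝓘(ℝ, E × E) 𝓘(ℝ, E) ∞ (fun p : E × E => (chartExp E p.2 : G)) (0, 0) :=
      ContMDiffAt.comp (0, 0) (g := (chartExp E : E → G)) hc contDiff_snd.contMDiff.contMDiffAt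
    exact h1.inv.mul h2
  have h1 : (chartExp E (0 : E) : G)⁻¹ * chartExp E (0 : E) = 1 := by simp
  have hF : ContDiffAt ℝ ∞
      (fun p : E × E => φ ((chartExp E p.1 : G)⁻¹ * chartExp E p.2) - φ 1) (0, 0) := by
    refine ContDiffAt.sub ?_ contDiffAt_const
    rw [← contMDiffAt_iff_contDiffAt]
    refine ContMDiffAt.comp (0, 0) (g := φ) ?_ hm
    rw [h1]
    exact contMDiffAt_extChartAt
  obtain ⟨K, t, ht, hK⟩ := (hF.of_le (m := 1) (by simp)).exists_lipschitzOnWith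
  have hsrc : ∀ᶠ p : E × E in nhds (0, 0),
      (chartExp E p.1 : G)⁻¹ * chartExp E p.2 ∈ φ.source := by
    refine hm.continuousAt.eventually_mem ?_
    rw [h1]
    exact extChartAt_source_mem_nhds 1
  obtain ⟨r, hr, hball⟩ := Metric.eventually_nhds_iff.1 (hsrc.and ht)
  refine ⟨K + 1, r, by positivity, hr, fun x y hx hy => ?_⟩
  have hmem (a b : E) (ha : ‖a‖ < r) (hb : ‖b‖ < r) := hball (y := (a, b)) (by
    rw [Prod.dist_eq]; simpa using ⟨ha, hb⟩)
  refine ⟨φ ((chartExp E x : G)⁻¹ * chartExp E y) - φ 1, ?_, ?_⟩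
  -- The pair (x, y) is compared with the diagonal pair (x, x), whose quotient is the identity; this
  -- makes the bound proportional to the distance of x and y.
  · have h := hK.dist_le_mul (x, y) (hmem x y hx hy).2 (x, x) (hmem x x hx hx).2
    simp only [inv_mul_cancel, sub_self, dist_zero_right, Prod.dist_eq, dist_self] at h
    rw [max_eq_right dist_nonneg, dist_comm, dist_eq_norm] at h
    refine h.trans ?_
    gcongr
    simp
  · change _ = φ.symm (φ 1 + _)
    rw [add_sub_cancel, φ.left_inv (hmem x y hx hy).1]

/-- Characters are Lipschitz near the identity, with a constant proportional to the frequency. -/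
theorem exists_norm_character_sub_one_le :
    ∃ C r : ℝ, 0 < C ∧ 0 < r ∧ ∀ (χ : LieCharacter E G) (x : E), ‖x‖ < r →
      ‖((χ (chartExp E x) : Circle) : ℂ) - 1‖ ≤ C * ‖frequency χ‖ * ‖x‖ := by
  obtain ⟨C, r, hC, hr, h⟩ := exists_chartExp_div E G
  refine ⟨C, r, hC, hr, fun χ x hx => ?_⟩
  -- The radius `r` must not depend on the character, whereas the differential controls it only very
  -- close to the identity. The segment from 0 to x is therefore cut into n short pieces. Each
  -- quotient of consecutive points is a chart point small enough for the first-order estimate, and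
  -- the n errors add up to at most `ε`.
  refine le_of_forall_pos_le_add fun ε hε => ?_
  have hx' : 0 < C * ‖x‖ + 1 := by positivity
  have hd : ∃ δ > 0, ∀ z : E, ‖z‖ < δ →
      ‖((χ (chartExp E z) : Circle) : ℂ) - 1‖ ≤ (‖frequency χ‖ + ε / (C * ‖x‖ + 1)) * ‖z‖ := by
    have h1 := χ.hasFDerivAt_chartExp.isLittleO.def (show 0 < ε / (C * ‖x‖ + 1) by positivity)
    obtain ⟨δ, hδ, h2⟩ := Metric.eventually_nhds_iff.1 h1
    refine ⟨δ, hδ, fun z hz => ?_⟩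
    have h3 := h2 (y := z) (by simpa using hz)
    simp only [chartExp_zero, map_one, Circle.coe_one, sub_zero] at h3
    have h4 := (characterDifferential χ).le_opNorm z
    rw [norm_characterDifferential] at h4
    calc _ = ‖(((χ (chartExp E z) : Circle) : ℂ) - 1 - characterDifferential χ z)
            + characterDifferential χ z‖ := by rw [sub_add_cancel]
      _ ≤ _ := (norm_add_le _ _).trans (by rw [add_mul]; linarith)
  obtain ⟨δ, hδ, hd⟩ := hd
  obtain ⟨n, hn⟩ := exists_nat_gt (C * ‖x‖ / δ)
  have hn0 : (0 : ℝ) < n := lt_of_le_of_lt (by positivity) hn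
  have hn1 : C * ‖x‖ / n < δ := by
    rw [div_lt_iff₀ hδ] at hn
    rw [div_lt_iff₀ hn0]; linarith
  have hstep : ∀ k, k < n →
      dist ((χ (chartExp E (((k : ℕ) / n : ℝ) • x)) : Circle) : ℂ)
        ((χ (chartExp E ((((k + 1 : ℕ) : ℝ) / n : ℝ) • x)) : Circle) : ℂ)
      ≤ (‖frequency χ‖ + ε / (C * ‖x‖ + 1)) * (C * ‖x‖ / n) := by
    intro k hk
    have hsm (j : ℕ) (hj : j ≤ n) : ‖((j : ℝ) / n) • x‖ < r := by
      refine lt_of_le_of_lt ?_ hx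
      rw [norm_smul, Real.norm_of_nonneg (by positivity)]
      exact mul_le_of_le_one_left (norm_nonneg _) (by
        rw [div_le_one hn0]; exact_mod_cast hj)
    obtain ⟨z, hz, hz'⟩ := h _ _ (hsm k hk.le) (hsm (k + 1) hk)
    have hzn : ‖z‖ ≤ C * ‖x‖ / n := by
      refine hz.trans (le_of_eq ?_)
      rw [← sub_smul, norm_smul, ← sub_div]
      push_cast
      rw [show (k : ℝ) - (k + 1) = -1 by ring, norm_div, norm_neg, norm_one,
        Real.norm_of_nonneg hn0.le]
      ring
    have : (χ (chartExp E ((((k + 1 : ℕ) : ℝ) / n : ℝ) • x)) : Circle)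
        = χ (chartExp E (((k : ℕ) / n : ℝ) • x)) * χ (chartExp E z) := by
      rw [← hz', map_mul, map_inv, mul_inv_cancel_left]
    rw [this, dist_comm, dist_eq_norm, Circle.coe_mul, ← mul_sub_one, norm_mul, Circle.norm_coe,
      one_mul]
    refine (hd z (hzn.trans_lt hn1)).trans ?_
    gcongr
  have hsum := dist_le_range_sum_of_dist_le
    (f := fun k : ℕ => ((χ (chartExp E (((k : ℕ) / n : ℝ) • x)) : Circle) : ℂ)) n
    (fun {k} hk => hstep k hk)
  simp only [Nat.cast_zero, zero_div, zero_smul, chartExp_zero, map_one, Circle.coe_one,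
    div_self hn0.ne', one_smul, Finset.sum_const, Finset.card_range, nsmul_eq_mul] at hsum
  rw [dist_comm, dist_eq_norm] at hsum
  refine hsum.trans ?_
  have e1 : (n : ℝ) * ((‖frequency χ‖ + ε / (C * ‖x‖ + 1)) * (C * ‖x‖ / n))
      = C * ‖frequency χ‖ * ‖x‖ + ε * (C * ‖x‖ / (C * ‖x‖ + 1)) := by
    field_simp
  rw [e1]
  have : C * ‖x‖ / (C * ‖x‖ + 1) ≤ 1 := by rw [div_le_one hx']; linarith
  nlinarith

end Lipschitz

/-! ### Counting characters and bounding the heat trace. -/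

section Counting

variable {E : Type*} [NormedAddCommGroup E] [InnerProductSpace ℝ E] [FiniteDimensional ℝ E]
  {G : Type*} [TopologicalSpace G] [ChartedSpace E G] [CommGroup G]
  [LieGroup 𝓘(ℝ, E) ∞ G] [CompactSpace G] [MeasurableSpace G] [BorelSpace G]

/-- Orthogonality of characters. -/
theorem integral_character (ν : Measure G) [ν.IsHaarMeasure] [IsProbabilityMeasure ν]
    [DecidableEq (LieCharacter E G)] (χ : LieCharacter E G) :
    ∫ g, ((χ g : Circle) : ℂ) ∂ν = if χ = 1 then 1 else 0 := by
  have := topologicalGroup_of_lieGroup 𝓘(ℝ, E) ∞ (G := G)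
  split_ifs with h
  · subst h; simp
  · obtain ⟨g₀, hg₀⟩ : ∃ g, χ g ≠ 1 := by
      by_contra! h'
      exact h (LieCharacter.ext h')
    have h1 := integral_mul_left_eq_self (μ := ν) (fun g : G => ((χ g : Circle) : ℂ)) g₀
    simp only [map_mul, Circle.coe_mul] at h1
    rw [integral_const_mul] at h1
    have h2 : (((χ g₀ : Circle) : ℂ) - 1) * ∫ g, ((χ g : Circle) : ℂ) ∂ν = 0 := by
      rw [sub_one_mul, h1, sub_self]
    rcases mul_eq_zero.1 h2 with h3 | h3
    · exact absurd (Circle.ext (by simpa [sub_eq_zero] using h3)) hg₀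
    · exact h3

theorem LieCharacter.integrable (ν : Measure G) [IsFiniteMeasure ν] (χ : LieCharacter E G) :
    Integrable (fun g => ((χ g : Circle) : ℂ)) ν :=
  Integrable.of_bound χ.continuous_coe.aestronglyMeasurable 1
    (ae_of_all _ fun g => (Circle.norm_coe _).le)

/-- Parseval: after expanding the square, only the diagonal terms survive the integration. -/
theorem integral_normSq_sum_character (ν : Measure G) [ν.IsHaarMeasure] [IsProbabilityMeasure ν]
    (T : Finset (LieCharacter E G)) :
    ∫ g, ‖∑ χ ∈ T, ((χ g : Circle) : ℂ)‖ ^ 2 ∂ν = T.card := by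
  classical
  have h1 (g : G) : ((‖∑ χ ∈ T, ((χ g : Circle) : ℂ)‖ ^ 2 : ℝ) : ℂ)
      = ∑ χ ∈ T, ∑ ψ ∈ T, (((χ * ψ⁻¹) g : Circle) : ℂ) := by
    push_cast
    rw [← Complex.mul_conj', map_sum, Finset.sum_mul_sum]
    simp only [LieCharacter.mul_apply, LieCharacter.inv_apply, Circle.coe_mul,
      Circle.coe_inv_eq_conj]
  have h2 : ((∫ g, ‖∑ χ ∈ T, ((χ g : Circle) : ℂ)‖ ^ 2 ∂ν : ℝ) : ℂ) = T.card := by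
    rw [← integral_complex_ofReal]
    simp only [h1]
    rw [integral_finsetSum _ fun χ _ => integrable_finsetSum _ fun ψ _ => (χ * ψ⁻¹).integrable ν]
    have h3 : ∀ χ ∈ T, ∫ g, ∑ ψ ∈ T, (((χ * ψ⁻¹) g : Circle) : ℂ) ∂ν = 1 := fun χ hχ => by
      rw [integral_finsetSum _ fun ψ _ => (χ * ψ⁻¹).integrable ν]
      simp only [integral_character, mul_inv_eq_one]
      simp [hχ]
    rw [Finset.sum_congr rfl h3]
    simp
  exact_mod_cast h2

variable (E G) in
theorem eventually_exists_chartExp {r : ℝ} (hr : 0 < r) :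
    ∀ᶠ g : G in nhds 1, ∃ x : E, ‖x‖ < r ∧ g = chartExp E x := by
  have h1 : ∀ᶠ g : G in nhds 1, g ∈ (extChartAt 𝓘(ℝ, E) (1 : G)).source :=
    extChartAt_source_mem_nhds 1
  have h2 : ∀ᶠ g : G in nhds 1,
      extChartAt 𝓘(ℝ, E) (1 : G) g ∈ Metric.ball (extChartAt 𝓘(ℝ, E) (1 : G) 1) r :=
    (continuousAt_extChartAt (I := 𝓘(ℝ, E)) (1 : G)).eventually_mem (Metric.ball_mem_nhds _ hr)
  filter_upwards [h1, h2] with g hg1 hg2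
  refine ⟨extChartAt 𝓘(ℝ, E) (1 : G) g - extChartAt 𝓘(ℝ, E) (1 : G) 1, ?_, ?_⟩
  · rwa [← dist_eq_norm]
  · rw [chartExp, add_sub_cancel, PartialEquiv.left_inv _ hg1]

/-- Only finitely many characters have frequency at most one. -/
theorem finite_norm_frequency_le (ν : Measure G) [ν.IsHaarMeasure] [IsProbabilityMeasure ν] :
    {χ : LieCharacter E G | ‖frequency χ‖ ≤ 1}.Finite := by
  obtain ⟨C, r, hC, hr, h⟩ := exists_norm_character_sub_one_le E G
  -- Within this radius a character of frequency at most one stays within 1/2 of one.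
  have hr' : 0 < min r (1 / (2 * C)) := by positivity
  obtain ⟨U, hU, hUo, hU1⟩ := eventually_nhds_iff.1 (eventually_exists_chartExp E G hr')
  have hν : 0 < ν.real U := by
    rw [measureReal_def]
    exact ENNReal.toReal_pos (hUo.measure_pos ν ⟨1, hU1⟩).ne' (measure_ne_top _ _)
  -- On `U` the summands have real part at least 1/2, so the sum over `T` is at least |T|/2 there,
  -- while its squared norm integrates to |T|. This gives |T|² ν(U)/4 ≤ |T|.
  have key (T : Finset (LieCharacter E G)) (hT : ∀ χ ∈ T, ‖frequency χ‖ ≤ 1) :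
      (T.card : ℝ) ≤ 4 / ν.real U := by
    have h1 : ∀ g ∈ U, (T.card : ℝ) ^ 2 / 4 ≤ ‖∑ χ ∈ T, ((χ g : Circle) : ℂ)‖ ^ 2 := by
      intro g hg
      obtain ⟨x, hx, rfl⟩ := hU g hg
      have h2 : (T.card : ℝ) / 2 ≤ ‖∑ χ ∈ T, ((χ (chartExp E x) : Circle) : ℂ)‖ := by
        refine le_trans ?_ (Complex.re_le_norm _)
        rw [Complex.re_sum, div_eq_mul_one_div, ← nsmul_eq_mul]
        refine Finset.card_nsmul_le_sum _ _ _ fun χ hχ => ?_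
        have h3 := h χ x (hx.trans_le (min_le_left _ _))
        have h4 : C * ‖frequency χ‖ * ‖x‖ ≤ 1 / 2 := by
          calc C * ‖frequency χ‖ * ‖x‖ ≤ C * 1 * (1 / (2 * C)) := by
                gcongr
                · exact hT χ hχ
                · exact hx.le.trans (min_le_right _ _)
            _ = 1 / 2 := by field_simp
        have h5 := (Complex.abs_re_le_norm _).trans (h3.trans h4)
        rw [Complex.sub_re, Complex.one_re, abs_le] at h5
        linarith [h5.1]
      calc (T.card : ℝ) ^ 2 / 4 = ((T.card : ℝ) / 2) ^ 2 := by ring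
        _ ≤ _ := by gcongr
    have hint : Integrable (fun g => ‖∑ χ ∈ T, ((χ g : Circle) : ℂ)‖ ^ 2) ν := by
      refine Integrable.of_bound (C := (T.card : ℝ) ^ 2) ?_ (ae_of_all _ fun g => ?_)
      · exact ((continuous_finsetSum _ fun χ _ => χ.continuous_coe).norm.pow 2).aestronglyMeasurable
      · rw [Real.norm_of_nonneg (by positivity)]
        gcongr
        refine (norm_sum_le_of_le _ fun χ _ => (Circle.norm_coe (χ g)).le).trans (by simp)
    have h6 : (T.card : ℝ) ^ 2 / 4 * ν.real U ≤ T.card := by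
      calc (T.card : ℝ) ^ 2 / 4 * ν.real U
          = ∫ g in U, (T.card : ℝ) ^ 2 / 4 ∂ν := by simp [mul_comm]
        _ ≤ ∫ g in U, ‖∑ χ ∈ T, ((χ g : Circle) : ℂ)‖ ^ 2 ∂ν :=
            setIntegral_mono_on (integrable_const _) hint.integrableOn hUo.measurableSet h1
        _ ≤ ∫ g, ‖∑ χ ∈ T, ((χ g : Circle) : ℂ)‖ ^ 2 ∂ν :=
            setIntegral_le_integral hint (ae_of_all _ fun g => by positivity)
        _ = T.card := integral_normSq_sum_character ν T
    rw [le_div_iff₀ hν]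
    rcases T.card.eq_zero_or_pos with h0 | h0
    · rw [h0]; norm_num
    · have h0' : (0 : ℝ) < T.card := by exact_mod_cast h0
      nlinarith
  obtain ⟨n, hn⟩ := exists_nat_ge (4 / ν.real U)
  by_contra hinf
  obtain ⟨T, hT, hTn⟩ := Set.Infinite.exists_subset_card_eq hinf (n + 1)
  have h7 := (key T fun χ hχ => hT hχ).trans hn
  rw [hTn] at h7
  have : n + 1 ≤ n := by exact_mod_cast h7
  omega

/-- Heat-trace bound by packing balls around the frequencies. -/
theorem exists_sum_exp_le (ν : Measure G) [ν.IsHaarMeasure] [IsProbabilityMeasure ν] :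
    ∃ C : ℝ, 0 < C ∧ ∀ α : ℝ, 0 < α → α ≤ 1 → ∀ T : Finset (LieCharacter E G),
      ∑ χ ∈ T, Real.exp (-(α * laplaceEigenvalue χ)) ≤
        C * ((Real.sqrt α)⁻¹) ^ Module.finrank ℝ E := by
  classical
  let _ : MeasurableSpace E := borel E
  have : BorelSpace E := ⟨rfl⟩
  have hfin := finite_norm_frequency_le (E := E) ν
  set N : ℕ := hfin.toFinset.card with hN
  have hNpos : 0 < N := Finset.card_pos.2 ⟨1, by simp [frequency_one]⟩
  set V : ℝ := volume.real (Metric.ball (0 : E) (1 / 2)) with hV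
  have hVpos : 0 < V :=
    ENNReal.toReal_pos (Metric.measure_ball_pos _ _ (by norm_num)).ne' measure_ball_lt_top.ne
  have hVv (v : E) : volume.real (Metric.ball v (1 / 2)) = V := by
    rw [measureReal_def, Measure.addHaar_ball_center, ← measureReal_def]
  set D := Module.finrank ℝ E
  -- `Real.exp (1 / 4)` is the loss in comparing the Gaussian weight at a frequency with its value
  -- on the ball around it, `N` bounds the overlap of the balls, `V` is their volume, and the power
  -- of the square root comes from the Gaussian integral.
  refine ⟨Real.exp (1 / 4) * N * (Real.sqrt (2 * Real.pi)) ^ D / V, by positivity,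
    fun α hα hα1 T => ?_⟩
  have hg0 : Integrable (fun x : E => Real.exp (-(α / 2) * ‖x‖ ^ 2)) := by
    have := (GaussianFourier.integrable_cexp_neg_mul_sq_norm_add (V := E) (b := ((α / 2 : ℝ) : ℂ))
      (by simpa using hα) 0 0).norm
    refine this.congr (ae_of_all _ fun x => ?_)
    simp only [Complex.norm_exp]
    congr 1
    simp [← Complex.ofReal_pow]
  set g : E → ℝ := fun x => Real.exp (1 / 4) * Real.exp (-(α / 2) * ‖x‖ ^ 2) with hgdef
  have hg : Integrable g := hg0.const_mul _
  have h1 (χ : LieCharacter E G) : V * Real.exp (-(α * laplaceEigenvalue χ)) ≤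
      ∫ x, (Metric.ball (frequency χ) (1 / 2)).indicator g x := by
    rw [integral_indicator Metric.isOpen_ball.measurableSet]
    calc V * Real.exp (-(α * laplaceEigenvalue χ))
        = ∫ x in Metric.ball (frequency χ) (1 / 2), Real.exp (-(α * laplaceEigenvalue χ)) := by
          rw [setIntegral_const, hVv, smul_eq_mul]
      _ ≤ _ := by
          refine setIntegral_mono_on (integrableOn_const measure_ball_lt_top.ne) hg.integrableOn
            Metric.isOpen_ball.measurableSet fun x hx => ?_
          rw [hgdef, laplaceEigenvalue_eq]
          simp only
          rw [← Real.exp_add]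
          apply Real.exp_le_exp.2
          have h2 : ‖x‖ ≤ ‖frequency χ‖ + 1 / 2 := by
            have h3 := norm_sub_norm_le x (frequency χ)
            rw [← dist_eq_norm] at h3
            linarith [Metric.mem_ball.1 hx]
          have h4 : ‖x‖ ^ 2 ≤ 2 * ‖frequency χ‖ ^ 2 + 1 / 2 := by
            have : ‖x‖ ^ 2 ≤ (‖frequency χ‖ + 1 / 2) ^ 2 := by gcongr
            nlinarith [sq_nonneg (‖frequency χ‖ - 1 / 2)]
          nlinarith
  have h2 (x : E) : ∑ χ ∈ T, (Metric.ball (frequency χ) (1 / 2)).indicator g x ≤ N * g x := by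
    have hgx : 0 ≤ g x := by positivity
    simp only [Set.indicator_apply]
    rw [← Finset.sum_filter, Finset.sum_const, nsmul_eq_mul]
    refine mul_le_mul_of_nonneg_right ?_ hgx
    norm_cast
    rcases (T.filter fun χ => x ∈ Metric.ball (frequency χ) (1 / 2)).eq_empty_or_nonempty with
      h0 | ⟨χ₀, h0⟩
    · rw [h0]; simp
    -- Two frequencies within 1/2 of the same point differ by less than one, so dividing by one such
    -- character embeds them all into the finite set of frequency at most one.
    · refine Finset.card_le_card_of_injOn (fun χ => χ * χ₀⁻¹) (fun χ hχ => ?_)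
        (fun a _ b _ hab => mul_right_cancel hab)
      simp only [Finset.coe_filter, Set.mem_ofPred_eq, Finset.mem_filter, Metric.mem_ball] at hχ h0
      simp only [Set.Finite.coe_toFinset, Set.mem_ofPred_eq, frequency_mul, frequency_inv,
        ← sub_eq_add_neg, ← dist_eq_norm]
      have := dist_triangle_left (frequency χ) (frequency χ₀) x
      linarith [hχ.2, h0.2]
  have h3 : V * ∑ χ ∈ T, Real.exp (-(α * laplaceEigenvalue χ)) ≤ N * ∫ x, g x := by
    rw [Finset.mul_sum, ← integral_const_mul]
    refine (Finset.sum_le_sum fun χ _ => h1 χ).trans ?_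
    rw [← integral_finsetSum _ fun χ _ => hg.indicator Metric.isOpen_ball.measurableSet]
    exact integral_mono (integrable_finsetSum _ fun χ _ =>
      hg.indicator Metric.isOpen_ball.measurableSet) (hg.const_mul _) h2
  have h4 : ∫ x, g x = Real.exp (1 / 4) * (Real.sqrt (2 * Real.pi) * (Real.sqrt α)⁻¹) ^ D := by
    rw [hgdef, integral_const_mul, GaussianFourier.integral_rexp_neg_mul_sq_norm (by positivity),
      Real.rpow_div_two_eq_sqrt _ (by positivity), Real.rpow_natCast]
    congr 2
    rw [← Real.sqrt_inv, ← Real.sqrt_mul (by positivity)]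
    congr 1
    field_simp
  rw [h4, mul_pow] at h3
  rw [div_mul_eq_mul_div, le_div_iff₀ hVpos]
  linarith

theorem laplaceEigenvalue_nonneg (χ : LieCharacter E G) : 0 ≤ laplaceEigenvalue χ :=
  sq_nonneg _

/-- The heat trace at times at least `M^{-2i}`, bounded by the scale. -/
theorem exists_sum_exp_le_scale (ν : Measure G) [ν.IsHaarMeasure] [IsProbabilityMeasure ν] :
    ∃ C : ℝ, 1 ≤ C ∧ ∀ M : ℝ, 1 < M → ∀ (i : ℕ) (α : ℝ), (M ^ (2 * i))⁻¹ ≤ α →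
      ∀ T : Finset (LieCharacter E G),
        ∑ χ ∈ T, Real.exp (-(α * laplaceEigenvalue χ)) ≤ C * (M ^ i) ^ Module.finrank ℝ E := by
  obtain ⟨C, hC, h⟩ := exists_sum_exp_le (E := E) ν
  refine ⟨max C 1, le_max_right _ _, fun M hM i α hα T => ?_⟩
  have hM0 : 0 < M := by linarith
  have h1 := h (M ^ (2 * i))⁻¹ (by positivity) (inv_le_one_of_one_le₀ (one_le_pow₀ hM.le)) T
  have h2 : (Real.sqrt (M ^ (2 * i))⁻¹)⁻¹ = M ^ i := by
    rw [Real.sqrt_inv, inv_inv, mul_comm, pow_mul, Real.sqrt_sq (by positivity)]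
  rw [h2] at h1
  calc _ ≤ ∑ χ ∈ T, Real.exp (-((M ^ (2 * i))⁻¹ * laplaceEigenvalue χ)) := by
        gcongr with χ _
        exact laplaceEigenvalue_nonneg χ
    _ ≤ _ := h1
    _ ≤ _ := by gcongr; exact le_max_left _ _

theorem summable_exp_laplaceEigenvalue (ν : Measure G) [ν.IsHaarMeasure] [IsProbabilityMeasure ν]
    {α : ℝ} (hα : 0 < α) :
    Summable fun χ : LieCharacter E G => Real.exp (-(α * laplaceEigenvalue χ)) := by
  obtain ⟨C, hC, h⟩ := exists_sum_exp_le_scale (E := E) ν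
  obtain ⟨n, hn⟩ := pow_unbounded_of_one_lt α⁻¹ (show (1 : ℝ) < 2 by norm_num)
  refine summable_of_sum_le (fun _ => (Real.exp_pos _).le) (h 2 (by norm_num) n α ?_)
  rw [inv_le_comm₀ (by positivity) hα]
  exact hn.le.trans (pow_le_pow_right₀ (by norm_num) (by omega))

end Counting

/-! ### The heat semigroup as a Gaussian average, and regularity of the heat kernel. -/

section HeatKernelBasic

variable {E : Type*} [NormedAddCommGroup E] [InnerProductSpace ℝ E] [FiniteDimensional ℝ E]
  {G : Type*} [TopologicalSpace G] [ChartedSpace E G] [CommGroup G]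

open scoped RealInnerProductSpace

/-- The powers of chart points lie in `G`, where the polynomial is non-negative, and their character
values converge to the exponentials. -/
theorem LieCharacter.exp_frequency_re_nonneg (c : LieCharacter E G →₀ ℂ)
    (hc : ∀ g : G, 0 ≤ (c.sum fun χ z => z * ((χ g : Circle) : ℂ)).re) (x : E) :
    0 ≤ (c.sum fun χ z => z * Complex.exp (Complex.I * (⟪frequency χ, x⟫ : ℝ))).re := by
  have h : Filter.Tendsto (fun n : ℕ => (c.sum fun χ z =>
      z * ((χ (chartExp E ((n : ℝ)⁻¹ • x) ^ n) : Circle) : ℂ)).re) Filter.atTop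
      (nhds (c.sum fun χ z => z * Complex.exp (Complex.I * (⟪frequency χ, x⟫ : ℝ))).re) := by
    refine (Complex.continuous_re.tendsto _).comp ?_
    refine tendsto_finsetSum _ fun χ _ => ?_
    have := χ.tendsto_chartExp_pow x
    rw [characterDifferential_apply, mul_comm] at this
    exact this.const_mul _
  exact ge_of_tendsto' h fun n => hc _

/-- The heat semigroup preserves positivity of trigonometric polynomials: it averages over a
Gaussian measure on the Lie algebra. -/
theorem LieCharacter.heat_re_nonneg (c : LieCharacter E G →₀ ℂ)
    (hc : ∀ g : G, 0 ≤ (c.sum fun χ z => z * ((χ g : Circle) : ℂ)).re) {α : ℝ} (hα : 0 < α) :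
    0 ≤ (c.sum fun χ z => z * (Real.exp (-(α * laplaceEigenvalue χ)) : ℂ)).re := by
  let _ : MeasurableSpace E := borel E
  have : BorelSpace E := ⟨rfl⟩
  -- With this width the Fourier transform of the Gaussian at a frequency is its mass times the heat
  -- factor at time `α`.
  set b : ℝ := 1 / (4 * α) with hb
  have hb0 : 0 < b := by positivity
  have hbre : 0 < ((b : ℝ) : ℂ).re := by simpa using hb0
  set Z : ℝ := ∫ x : E, Real.exp (-b * ‖x‖ ^ 2) with hZ
  have hZpos : 0 < Z := by
    rw [hZ, GaussianFourier.integral_rexp_neg_mul_sq_norm hb0]; positivity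
  have hZc : (Z : ℂ) = (Real.pi / (b : ℂ)) ^ (Module.finrank ℝ E / 2 : ℂ) := by
    rw [← GaussianFourier.integral_cexp_neg_mul_sq_norm (V := E) hbre, hZ,
      ← integral_complex_ofReal]
    simp
  have h1 (χ : LieCharacter E G) :
      ∫ x : E, Complex.exp (-(b : ℂ) * ‖x‖ ^ 2 + Complex.I * (⟪frequency χ, x⟫ : ℝ)) =
        Z * (Real.exp (-(α * laplaceEigenvalue χ)) : ℂ) := by
    rw [GaussianFourier.integral_cexp_neg_mul_sq_norm_add hbre, ← hZc, laplaceEigenvalue_eq,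
      Complex.ofReal_exp]
    congr 2
    rw [hb]
    push_cast
    have : (α : ℂ) ≠ 0 := by exact_mod_cast hα.ne'
    rw [Complex.I_sq]
    field_simp
  have h2 : (Z : ℂ) * (c.sum fun χ z => z * (Real.exp (-(α * laplaceEigenvalue χ)) : ℂ)) =
      ∫ x : E, c.sum fun χ z =>
        z * Complex.exp (-(b : ℂ) * ‖x‖ ^ 2 + Complex.I * (⟪frequency χ, x⟫ : ℝ)) := by
    simp only [Finsupp.sum]
    rw [integral_finsetSum _ fun χ _ =>
      (GaussianFourier.integrable_cexp_neg_mul_sq_norm_add hbre _ _).const_mul _, Finset.mul_sum]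
    refine Finset.sum_congr rfl fun χ _ => ?_
    rw [integral_const_mul, h1]
    ring
  have hint : Integrable fun x : E => c.sum fun χ z =>
        z * Complex.exp (-(b : ℂ) * ‖x‖ ^ 2 + Complex.I * (⟪frequency χ, x⟫ : ℝ)) :=
    integrable_finsetSum _ fun χ _ =>
      (GaussianFourier.integrable_cexp_neg_mul_sq_norm_add hbre _ _).const_mul _
  have h3 : 0 ≤ Z * (c.sum fun χ z => z * (Real.exp (-(α * laplaceEigenvalue χ)) : ℂ)).re := by
    rw [← Complex.re_ofReal_mul, h2]
    refine le_of_le_of_eq ?_ (integral_re hint)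
    refine integral_nonneg fun x => ?_
    have h4 : (c.sum fun χ z =>
        z * Complex.exp (-(b : ℂ) * ‖x‖ ^ 2 + Complex.I * (⟪frequency χ, x⟫ : ℝ))) =
        ((Real.exp (-b * ‖x‖ ^ 2) : ℝ) : ℂ) *
          c.sum fun χ z => z * Complex.exp (Complex.I * (⟪frequency χ, x⟫ : ℝ)) := by
      rw [Finsupp.mul_sum]
      refine Finsupp.sum_congr fun χ _ => ?_
      rw [Complex.exp_add]
      push_cast
      ring
    rw [h4]
    change 0 ≤ Complex.re _
    rw [Complex.re_ofReal_mul]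
    exact mul_nonneg (Real.exp_pos _).le (exp_frequency_re_nonneg c hc x)
  exact nonneg_of_mul_nonneg_right h3 hZpos

theorem norm_heatKernel_term (α : ℝ) (χ : LieCharacter E G) (g : G) :
    ‖(Real.exp (-(α * laplaceEigenvalue χ)) : ℂ) * ((χ g : Circle) : ℂ)‖ =
      Real.exp (-(α * laplaceEigenvalue χ)) := by
  rw [norm_mul, Circle.norm_coe, mul_one, Complex.norm_real,
    Real.norm_of_nonneg (Real.exp_pos _).le]

variable [LieGroup 𝓘(ℝ, E) ∞ G] [CompactSpace G] [MeasurableSpace G] [BorelSpace G]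

theorem countable_lieCharacter (ν : Measure G) [ν.IsHaarMeasure] [IsProbabilityMeasure ν] :
    Countable (LieCharacter E G) := by
  have := (summable_exp_laplaceEigenvalue (E := E) ν one_pos).countable_support
  rw [Function.support_eq_univ fun χ => (Real.exp_pos _).ne'] at this
  exact Set.countable_univ_iff.1 this

theorem summable_heatKernel (ν : Measure G) [ν.IsHaarMeasure] [IsProbabilityMeasure ν]
    {α : ℝ} (hα : 0 < α) (g : G) :
    Summable fun χ : LieCharacter E G =>
      (Real.exp (-(α * laplaceEigenvalue χ)) : ℂ) * ((χ g : Circle) : ℂ) := by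
  refine Summable.of_norm ?_
  simpa only [norm_heatKernel_term] using summable_exp_laplaceEigenvalue ν hα

theorem exists_norm_heatKernel_le (ν : Measure G) [ν.IsHaarMeasure] [IsProbabilityMeasure ν] :
    ∃ C : ℝ, 1 ≤ C ∧ ∀ M : ℝ, 1 < M → ∀ (i : ℕ) (α : ℝ), (M ^ (2 * i))⁻¹ ≤ α →
      ∀ g : G, ‖heatKernel E α g‖ ≤ C * (M ^ i) ^ Module.finrank ℝ E := by
  obtain ⟨C, hC, h⟩ := exists_sum_exp_le_scale (E := E) ν
  refine ⟨C, hC, fun M hM i α hα g => ?_⟩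
  have hα0 : 0 < α := lt_of_lt_of_le (by positivity) hα
  have hs := summable_exp_laplaceEigenvalue (E := E) ν hα0
  refine (norm_tsum_le_tsum_norm ?_).trans ?_
  · simpa only [norm_heatKernel_term] using hs
  · simp only [norm_heatKernel_term]
    exact hs.tsum_le_of_sum_le (h M hM i α hα)

theorem continuousOn_heatKernel (ν : Measure G) [ν.IsHaarMeasure] [IsProbabilityMeasure ν] :
    ContinuousOn (fun p : ℝ × G => heatKernel E p.1 p.2) (Set.Ioi 0 ×ˢ Set.univ) := by
  intro p hp
  have hp1 : 0 < p.1 := hp.1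
  have h : ContinuousOn (fun p : ℝ × G => heatKernel E p.1 p.2)
      (Set.Ioi (p.1 / 2) ×ˢ Set.univ) := by
    refine continuousOn_tsum (fun χ => ?_)
      (summable_exp_laplaceEigenvalue (E := E) ν (half_pos hp1)) fun χ q hq => ?_
    · refine Continuous.continuousOn ?_
      have := χ.continuous_coe
      fun_prop
    · rw [norm_heatKernel_term]
      have := mul_le_mul_of_nonneg_right (le_of_lt hq.1) (laplaceEigenvalue_nonneg χ)
      exact Real.exp_le_exp.2 (by linarith)
  exact (h.continuousAt ((isOpen_Ioi.prod isOpen_univ).mem_nhds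
    ⟨Set.mem_Ioi.2 (half_lt_self hp1), Set.mem_univ _⟩)).continuousWithinAt

theorem continuous_heatKernel (ν : Measure G) [ν.IsHaarMeasure] [IsProbabilityMeasure ν]
    {α : ℝ} (hα : 0 < α) :
    Continuous (heatKernel E α : G → ℂ) :=
  (continuousOn_heatKernel (E := E) ν).comp_continuous (f := fun g : G => (α, g)) (by fun_prop)
    fun g => ⟨hα, Set.mem_univ _⟩

/-- Absolute summability allows termwise integration; orthogonality leaves only the inverse of `ψ`,
which has the same eigenvalue. -/
theorem integral_heatKernel_mul_character (ν : Measure G) [ν.IsHaarMeasure] [IsProbabilityMeasure ν]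
    {α : ℝ} (hα : 0 < α) (ψ : LieCharacter E G) :
    ∫ g, heatKernel E α g * ((ψ g : Circle) : ℂ) ∂ν = Real.exp (-(α * laplaceEigenvalue ψ)) := by
  classical
  have := countable_lieCharacter (E := E) ν
  have h := hasSum_integral_of_summable_integral_norm (μ := ν)
    (F := fun (χ : LieCharacter E G) (g : G) =>
      ((Real.exp (-(α * laplaceEigenvalue χ)) : ℂ)) * (((χ * ψ) g : Circle) : ℂ))
    (fun χ => ((χ * ψ).integrable ν).const_mul _) (by
      simpa only [norm_mul, Circle.norm_coe, mul_one, Complex.norm_real, integral_const,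
        probReal_univ, one_smul, Real.norm_of_nonneg (Real.exp_pos _).le] using
        summable_exp_laplaceEigenvalue (E := E) ν hα)
  simp only [integral_const_mul, integral_character] at h
  have h2 := h.unique (hasSum_single (ψ⁻¹) fun χ hχ => by
    rw [if_neg (fun h => hχ (eq_inv_of_mul_eq_one_left h)), mul_zero])
  rw [if_pos (inv_mul_cancel ψ), mul_one] at h2
  have h3 : laplaceEigenvalue ψ⁻¹ = laplaceEigenvalue ψ := by
    simp [laplaceEigenvalue_eq, frequency_inv]
  rw [h3] at h2
  rw [← h2]
  refine integral_congr_ae (ae_of_all _ fun g => ?_)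
  simp only [heatKernel]
  rw [← tsum_mul_right]
  simp [mul_assoc]

/-- Conjugation permutes the series by inverting characters and preserves eigenvalues. -/
theorem heatKernel_im (α : ℝ) (g : G) : (heatKernel E α g).im = 0 := by
  rw [← Complex.conj_eq_iff_im, heatKernel, Complex.conj_tsum,
    ← (Equiv.inv (LieCharacter E G)).tsum_eq]
  refine tsum_congr fun χ => ?_
  have h3 : laplaceEigenvalue χ⁻¹ = laplaceEigenvalue χ := by
    simp [laplaceEigenvalue_eq, frequency_inv]
  simp only [Equiv.inv_apply, LieCharacter.inv_apply, map_mul, Complex.conj_ofReal, h3,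
    Circle.coe_inv_eq_conj, Complex.conj_conj]

end HeatKernelBasic

/-! ### Positivity and normalization of the heat kernel. -/

section HeatKernelPositive

variable (E : Type*) [NormedAddCommGroup E] [InnerProductSpace ℝ E] [FiniteDimensional ℝ E]
  (G : Type*) [TopologicalSpace G] [ChartedSpace E G] [CommGroup G]

/-- A character as a continuous complex function. -/
noncomputable def characterHom : LieCharacter E G →* C(G, ℂ) where
  toFun χ := ⟨fun g => ((χ g : Circle) : ℂ), χ.continuous_coe⟩
  map_one' := by ext; simp
  map_mul' _ _ := by ext; simp

/-- The evaluation of formal combinations of characters as trigonometric polynomials. -/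
noncomputable def trigPolynomial : MonoidAlgebra ℂ (LieCharacter E G) →ₐ[ℂ] C(G, ℂ) :=
  MonoidAlgebra.lift ℂ _ _ (characterHom E G)

variable {E G} in
theorem trigPolynomial_apply (p : MonoidAlgebra ℂ (LieCharacter E G)) (g : G) :
    trigPolynomial E G p g = p.coeff.sum fun χ z => z * ((χ g : Circle) : ℂ) := by
  rw [trigPolynomial, MonoidAlgebra.lift_apply, Finsupp.sum, ContinuousMap.sum_apply]
  rfl

/-- The algebra of real trigonometric polynomials. -/
noncomputable def realTrigPolynomials : Subalgebra ℝ C(G, ℝ) :=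
  ((trigPolynomial E G).range.restrictScalars ℝ).comap
    (Complex.ofRealAm.compLeftContinuous ℝ Complex.continuous_ofReal)

variable {E G}

theorem mem_realTrigPolynomials {f : C(G, ℝ)} :
    f ∈ realTrigPolynomials E G ↔
      ∃ p : MonoidAlgebra ℂ (LieCharacter E G), ∀ g, trigPolynomial E G p g = f g := by
  constructor
  · rintro ⟨p, hp⟩
    exact ⟨p, fun g => DFunLike.congr_fun hp g⟩
  · rintro ⟨p, hp⟩
    exact ⟨p, ContinuousMap.ext hp⟩

/-- The real part of a character. -/
noncomputable def characterRe (χ : LieCharacter E G) : C(G, ℝ) :=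
  ⟨fun g => ((χ g : Circle) : ℂ).re, Complex.continuous_re.comp χ.continuous_coe⟩

theorem characterRe_mem (χ : LieCharacter E G) : characterRe χ ∈ realTrigPolynomials E G := by
  refine mem_realTrigPolynomials.2 ⟨(1 / 2 : ℂ) • (MonoidAlgebra.of ℂ _ χ +
    MonoidAlgebra.of ℂ _ χ⁻¹), fun g => ?_⟩
  have h (ψ : LieCharacter E G) : trigPolynomial E G (MonoidAlgebra.of ℂ _ ψ) g =
      ((ψ g : Circle) : ℂ) := by
    rw [trigPolynomial, MonoidAlgebra.lift_of]; rfl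
  rw [map_smul, map_add, ContinuousMap.smul_apply, ContinuousMap.add_apply, h, h]
  simp only [characterRe, ContinuousMap.coe_mk, LieCharacter.inv_apply, Circle.coe_inv_eq_conj,
    Complex.re_eq_add_conj, smul_eq_mul]
  ring

variable [LieGroup 𝓘(ℝ, E) ∞ G] [CompactSpace G] [MeasurableSpace G] [BorelSpace G]

/-- The heat kernel pairs non-negatively with non-negative trigonometric polynomials. -/
theorem integral_heatKernel_mul_nonneg (ν : Measure G) [ν.IsHaarMeasure] [IsProbabilityMeasure ν]
    {α : ℝ} (hα : 0 < α) {f : C(G, ℝ)} (hf : f ∈ realTrigPolynomials E G) (h0 : ∀ g, 0 ≤ f g) :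
    0 ≤ ∫ g, (heatKernel E α g).re * f g ∂ν := by
  obtain ⟨p, hp⟩ := mem_realTrigPolynomials.1 hf
  have hK := continuous_heatKernel (E := E) ν hα
  have h1 := LieCharacter.heat_re_nonneg p.coeff (fun g => by
    rw [← trigPolynomial_apply, hp]; exact h0 g) hα
  have h2 : p.coeff.sum (fun χ z => z * (Real.exp (-(α * laplaceEigenvalue χ)) : ℂ)) =
      ∫ g, heatKernel E α g * f g ∂ν := by
    simp only [← hp, trigPolynomial_apply, Finsupp.sum, Finset.mul_sum]
    rw [integral_finsetSum]
    · refine Finset.sum_congr rfl fun χ _ => ?_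
      rw [← integral_heatKernel_mul_character ν hα, ← integral_const_mul]
      congr 1
      ext g
      ring
    · intro χ _
      have := χ.continuous_coe
      exact Continuous.integrable_of_hasCompactSupport (by fun_prop)
        (HasCompactSupport.of_compactSpace _)
  have hint : Integrable (fun g => heatKernel E α g * f g) ν :=
    Continuous.integrable_of_hasCompactSupport (by fun_prop) (HasCompactSupport.of_compactSpace _)
  rw [h2] at h1
  refine h1.trans_eq ((integral_re hint).symm.trans ?_)
  congr 1
  ext g
  exact Complex.re_mul_ofReal _ _

/-- The kernel is tested against its own negative part f. Both lie in the uniform closure of the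
real trigonometric polynomials, because a closed subalgebra of C(G, ℝ) is stable under suprema. The
pairing is non-negative, yet it equals minus the integral of f², so f vanishes. Density of
trigonometric polynomials among all continuous functions is not needed. -/
theorem heatKernel_re_nonneg (ν : Measure G) [ν.IsHaarMeasure] [IsProbabilityMeasure ν]
    {α : ℝ} (hα : 0 < α) (g : G) : 0 ≤ (heatKernel E α g).re := by
  have hK := continuous_heatKernel (E := E) ν hα
  set A := (realTrigPolynomials E G).topologicalClosure with hA
  have hAc : IsClosed (A : Set C(G, ℝ)) := Subalgebra.isClosed_topologicalClosure _
  set s : C(G, ℝ) := ⟨fun g => (heatKernel E α g).re, Complex.continuous_re.comp hK⟩ with hs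
  have hsum : HasSum (fun χ : LieCharacter E G =>
      Real.exp (-(α * laplaceEigenvalue χ)) • characterRe χ) s := by
    have h1 : Summable (fun χ : LieCharacter E G =>
        Real.exp (-(α * laplaceEigenvalue χ)) • characterRe χ) := by
      refine Summable.of_norm_bounded (summable_exp_laplaceEigenvalue (E := E) ν hα) fun χ => ?_
      rw [norm_smul, Real.norm_of_nonneg (Real.exp_pos _).le]
      refine mul_le_of_le_one_right (Real.exp_pos _).le ?_
      refine (ContinuousMap.norm_le _ zero_le_one).2 fun x => ?_
      exact (Complex.abs_re_le_norm _).trans (Circle.norm_coe _).le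
    convert h1.hasSum using 1
    ext x
    have h2 := h1.hasSum.mapL (ContinuousMap.evalCLM ℝ x)
    have h3 := Complex.hasSum_re (summable_heatKernel (E := E) ν hα x).hasSum
    refine h3.unique ?_
    refine (congrArg (HasSum · _) (funext fun χ => ?_)).mpr h2
    exact Complex.re_ofReal_mul _ _
  have hsA : s ∈ A := hAc.mem_of_tendsto hsum (Filter.Eventually.of_forall fun T =>
    sum_mem fun χ _ => A.smul_mem (Subalgebra.le_topologicalClosure _ (characterRe_mem χ)) _)
  set f : C(G, ℝ) := (-s) ⊔ 0 with hf
  have hfA : f ∈ A := ContinuousMap.sup_mem_closed_subalgebra A hAc ⟨-s, neg_mem hsA⟩ 0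
  have hint (u v : C(G, ℝ)) : Integrable (fun g => u g * v g) ν :=
    Continuous.integrable_of_hasCompactSupport (by fun_prop) (HasCompactSupport.of_compactSpace _)
  have h1 : 0 ≤ ∫ x, s x * f x ∂ν := by
    refine le_of_forall_pos_le_add fun ε hε => ?_
    -- Adding `δ` to a `δ`-approximation of f restores non-negativity and changes f by at most `2 *
    -- δ`, hence the pairing by at most `ε`.
    set δ := ε / (2 * (‖s‖ + 1)) with hδ
    have hδ0 : 0 < δ := by positivity
    obtain ⟨u, hu, huf⟩ := Metric.mem_closure_iff.1
      (show f ∈ closure (realTrigPolynomials E G : Set C(G, ℝ)) from hfA) δ hδ0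
    have huf' (x : G) : |u x - f x| ≤ δ := by
      rw [← Real.dist_eq, dist_comm]
      exact (ContinuousMap.dist_apply_le_dist x).trans huf.le
    have h2 := integral_heatKernel_mul_nonneg (E := E) ν hα
      (f := u + algebraMap ℝ C(G, ℝ) δ) (add_mem hu (Subalgebra.algebraMap_mem _ _)) (fun x => by
        have := (abs_le.1 (huf' x)).1
        have h3 : 0 ≤ f x := le_max_right _ _
        simp only [ContinuousMap.add_apply, algebraMap_apply, smul_eq_mul, mul_one]
        linarith)
    refine h2.trans ?_
    have h4 : ∫ x, s x * (u + algebraMap ℝ C(G, ℝ) δ) x ∂ν ≤ ∫ x, (s x * f x + ε) ∂ν := by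
      refine integral_mono (hint _ _) ((hint _ _).add (integrable_const _)) fun x => ?_
      have h5 : |s x| ≤ ‖s‖ := s.norm_coe_le_norm x
      have h6 : |u x - f x + δ| ≤ 2 * δ := by
        have := abs_le.1 (huf' x)
        rw [abs_le]; constructor <;> linarith
      have h7 : s x * (u x - f x + δ) ≤ ε := by
        calc s x * (u x - f x + δ) ≤ |s x * (u x - f x + δ)| := le_abs_self _
          _ = |s x| * |u x - f x + δ| := abs_mul _ _
          _ ≤ (‖s‖ + 1) * (2 * δ) := by gcongr; linarith
          _ = ε := by rw [hδ]; field_simp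
      simp only [ContinuousMap.add_apply, algebraMap_apply, smul_eq_mul, mul_one]
      linarith
    rw [integral_add (hint _ _) (integrable_const _)] at h4
    rw [integral_const, probReal_univ, one_smul] at h4
    exact h4
  have h2 (x : G) : s x * f x = -(f x * f x) := by
    have : f x = max (-(s x)) 0 := rfl
    rw [this]
    rcases max_cases (-(s x)) 0 with ⟨h, _⟩ | ⟨h, _⟩ <;> rw [h] <;> ring
  simp only [h2, integral_neg] at h1
  have h3 : ∫ x, f x * f x ∂ν = 0 :=
    le_antisymm (by linarith) (integral_nonneg fun x => mul_self_nonneg _)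
  rw [integral_eq_zero_iff_of_nonneg (fun x => mul_self_nonneg _) (hint f f)] at h3
  have h4 := (Continuous.ae_eq_iff_eq ν (f.continuous.mul f.continuous) continuous_const).1 h3
  have h5 : f g = 0 := mul_self_eq_zero.1 (congrFun h4 g)
  have h6 : -(s g) ≤ f g := le_max_left _ _
  rw [h5] at h6
  change 0 ≤ s g
  linarith

theorem heatKernel_eq_norm (ν : Measure G) [ν.IsHaarMeasure] [IsProbabilityMeasure ν]
    {α : ℝ} (hα : 0 < α) (g : G) : heatKernel E α g = (‖heatKernel E α g‖ : ℂ) := by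
  have h : heatKernel E α g = ((heatKernel E α g).re : ℂ) :=
    Complex.ext rfl (by simp [heatKernel_im])
  rw [h, Complex.norm_real, Real.norm_of_nonneg (heatKernel_re_nonneg ν hα g)]

theorem integral_norm_heatKernel (ν : Measure G) [ν.IsHaarMeasure] [IsProbabilityMeasure ν]
    {α : ℝ} (hα : 0 < α) : ∫ g, ‖heatKernel E α g‖ ∂ν = 1 := by
  have h := integral_heatKernel_mul_character (E := E) ν hα 1
  simp only [LieCharacter.one_apply, Circle.coe_one, mul_one, laplaceEigenvalue_eq, frequency_one,
    norm_zero] at h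
  have h2 : ((∫ g, ‖heatKernel E α g‖ ∂ν : ℝ) : ℂ) = 1 := by
    rw [← integral_complex_ofReal]
    simp only [← heatKernel_eq_norm (E := E) ν hα]
    rw [h]; simp
  exact_mod_cast h2

end HeatKernelPositive

/-! ### Power counting of the face-connected components -/

/-- A family of vectors with a finite decreasing filtration of its index set has a basis adapted
to the filtration. -/
theorem exists_linearIndepOn_adapted {ι K V : Type*} [DivisionRing K] [AddCommGroup V] [Module K V]
    (v : ι → V) (N : ℕ) : ∀ F : ℕ → Set ι, Antitone F → (∀ n, N ≤ n → F n = ∅) →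
      ∃ S ⊆ F 0, LinearIndepOn K v S ∧ ∀ i, v '' F i ⊆ Submodule.span K (v '' (S ∩ F i)) := by
  induction N with
  | zero =>
    intro F _ h
    exact ⟨∅, Set.empty_subset _, linearIndepOn_empty K v, fun i => by simp [h i (Nat.zero_le i)]⟩
  | succ N ih =>
    intro F hF h
    -- The shifted filtration supplies a basis adapted to all deeper levels; extending it to the top
    -- level leaves those spans intact.
    obtain ⟨S', hS', hli, hsp⟩ := ih (fun n => F (n + 1)) (fun a b hab => hF (by omega))
      (fun n hn => h (n + 1) (by omega))
    obtain ⟨S, hS, hSS, hspan, hlin⟩ := exists_linearIndepOn_extension hli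
      (hS'.trans (hF (Nat.zero_le 1)))
    refine ⟨S, hS, hlin, fun i => ?_⟩
    cases i with
    | zero => rwa [Set.inter_eq_left.2 hS]
    | succ i =>
      exact (hsp i).trans (Submodule.span_mono (Set.image_mono (Set.inter_subset_inter_left _ hSS)))

theorem Finset.prod_zpow_eq_zpow_sum {ι F : Type*} [Field F] {x : F} (hx : x ≠ 0) (s : Finset ι)
    (n : ι → ℤ) : ∏ i ∈ s, x ^ n i = x ^ ∑ i ∈ s, n i := by
  classical
  induction s using Finset.induction_on with
  | empty => simp
  | insert a s ha ih => rw [prod_insert ha, sum_insert ha, ih, zpow_add₀ hx]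

namespace FeynmanGraph

variable {d : ℕ} {Γ : FeynmanGraph d}

theorem Face.exists_through (f : Γ.Face) : ∃ e, f.Through e :=
  ⟨_, Quotient.out_eq f.2⟩

/-- Each line lies on exactly one face of each colour. This turns constants per face into constants
per line. -/
theorem card_face_le : Fintype.card Γ.Face ≤ d * Fintype.card Γ.Line := by
  classical
  let F : Fin d × Γ.Line → Γ.Face := fun p => ⟨p.1, Quotient.mk (Γ.faceSetoid p.1) p.2⟩
  have h : Function.Surjective F := by
    rintro ⟨ℓ, q⟩
    obtain ⟨e, rfl⟩ := Quotient.exists_rep q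
    exact ⟨(ℓ, e), rfl⟩
  refine (Fintype.card_le_of_surjective _ h).trans_eq ?_
  rw [Fintype.card_prod, Fintype.card_fin]

/-- The lowest scale of the lines of a face. -/
noncomputable def Face.scale (μ : Γ.Line → ℕ) (f : Γ.Face) : ℕ :=
  sInf {n | ∃ e, f.Through e ∧ μ e = n}

theorem Face.le_scale_iff {μ : Γ.Line → ℕ} {f : Γ.Face} {i : ℕ} :
    i ≤ f.scale μ ↔ ∀ e, f.Through e → i ≤ μ e := by
  obtain ⟨e₀, he₀⟩ := f.exists_through
  constructor
  · intro h e he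
    exact h.trans (Nat.sInf_le ⟨e, he, rfl⟩)
  · intro h
    obtain ⟨e, he, he'⟩ := Nat.sInf_mem (s := {n | ∃ e, f.Through e ∧ μ e = n}) ⟨_, e₀, he₀, rfl⟩
    rw [Face.scale, ← he']
    exact h e he

theorem Face.exists_scale_eq (μ : Γ.Line → ℕ) (f : Γ.Face) :
    ∃ e, f.Through e ∧ μ e = f.scale μ := by
  obtain ⟨e₀, he₀⟩ := f.exists_through
  exact Nat.sInf_mem (s := {n | ∃ e, f.Through e ∧ μ e = n}) ⟨_, e₀, he₀, rfl⟩

theorem mem_internalFaces {H : Finset Γ.Line} {f : Γ.Face} :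
    f ∈ internalFaces H ↔ f.Closed ∧ ∀ e, f.Through e → e ∈ H := by
  simp [internalFaces]

theorem mem_internalFaces_linesAbove {μ : Γ.Line → ℕ} {i : ℕ} {f : Γ.Face} :
    f ∈ internalFaces (linesAbove μ i) ↔ f.Closed ∧ i ≤ f.scale μ := by
  rw [mem_internalFaces, Face.le_scale_iff]
  simp [linesAbove]

theorem internalFaces_mono {H H' : Finset Γ.Line} (h : H ⊆ H') :
    internalFaces H ⊆ internalFaces H' := fun f hf => by
  rw [mem_internalFaces] at hf ⊢
  exact ⟨hf.1, fun e he => h (hf.2 e he)⟩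

/-- The column of a face in the incidence matrix. -/
noncomputable def incidenceColumn (o : Γ.Orientation) (f : Γ.Face) : Γ.Line → ℚ :=
  fun e => incidence o e f

theorem incidence_eq_zero {o : Γ.Orientation} {e : Γ.Line} {f : Γ.Face} (h : ¬ f.Through e) :
    incidence o e f = 0 := by
  simp [incidence, h]

theorem faceComponents_subset {H C : Finset Γ.Line} (hC : C ∈ faceComponents H) : C ⊆ H := by
  classical
  obtain ⟨e, _, rfl⟩ := Finset.mem_image.1 hC
  intro e' he'
  exact (Finset.mem_filter.1 he').1

theorem mem_faceComponent_of_rel {H C : Finset Γ.Line} (hC : C ∈ faceComponents H) {e e' : Γ.Line}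
    (he : e ∈ C) (he' : e' ∈ H) (h : Relation.EqvGen (ShareFace H) e e') : e' ∈ C := by
  classical
  obtain ⟨e₀, _, rfl⟩ := Finset.mem_image.1 hC
  exact Finset.mem_filter.2 ⟨he', (Finset.mem_filter.1 he).2.trans _ _ _ h⟩

/-- An internal face joins all its lines, so it cannot straddle two components. -/
theorem mem_internalFaces_component {H C : Finset Γ.Line} (hC : C ∈ faceComponents H) {e : Γ.Line}
    (he : e ∈ C) {f : Γ.Face} (hf : f ∈ internalFaces H) (hfe : f.Through e) :
    f ∈ internalFaces C :=
  mem_internalFaces.2 ⟨(mem_internalFaces.1 hf).1, fun e' he' => mem_faceComponent_of_rel hC he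
    ((mem_internalFaces.1 hf).2 e' he') (.rel _ _ ⟨f, hf, hfe, he'⟩)⟩

theorem exists_component_of_mem_internalFaces {H : Finset Γ.Line} {f : Γ.Face}
    (hf : f ∈ internalFaces H) : ∃ C ∈ faceComponents H, f ∈ internalFaces C := by
  classical
  obtain ⟨e, he⟩ := f.exists_through
  have heH := (mem_internalFaces.1 hf).2 e he
  have hC : (H.filter fun e' => Relation.EqvGen (ShareFace H) e e') ∈ faceComponents H :=
    Finset.mem_image_of_mem _ heH
  exact ⟨_, hC, mem_internalFaces_component hC
    (Finset.mem_filter.2 ⟨heH, .refl _⟩) hf he⟩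

theorem sum_card_faceComponents_le (H : Finset Γ.Line) :
    ∑ C ∈ faceComponents H, C.card ≤ H.card := by
  classical
  rw [← Finset.card_biUnion]
  · exact Finset.card_le_card (Finset.biUnion_subset.2 fun C hC => faceComponents_subset hC)
  · intro C hC C' hC' hne
    refine Finset.disjoint_left.2 fun e he he' => ?_
    refine hne ?_
    obtain ⟨e₀, _, rfl⟩ := Finset.mem_image.1 hC
    obtain ⟨e₁, _, rfl⟩ := Finset.mem_image.1 hC'
    have h0 := (Finset.mem_filter.1 he).2
    have h1 := (Finset.mem_filter.1 he').2
    ext x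
    simp only [Finset.mem_filter, and_congr_right_iff]
    exact fun _ => ⟨fun h => (h1.trans _ _ _ h0.symm).trans _ _ _ h,
      fun h => (h0.trans _ _ _ h1.symm).trans _ _ _ h⟩

open Classical in
-- Restrict the columns to the lines of `C`. Internal faces of `H` that are not internal to `C`
-- avoid these lines and restrict to zero, so the remaining faces of `S` already span the columns of
-- `C`.
theorem incidenceRank_component_le {o : Γ.Orientation} {H C : Finset Γ.Line}
    (hC : C ∈ faceComponents H) {S : Finset Γ.Face}
    (hS : incidenceColumn o '' (internalFaces H : Set Γ.Face) ⊆
      Submodule.span ℚ (incidenceColumn o '' (S ∩ internalFaces H : Finset Γ.Face))) :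
    incidenceRank o C ≤ (internalFaces C ∩ S).card := by
  set ρ : (Γ.Line → ℚ) →ₗ[ℚ] ({e // e ∈ C} → ℚ) := LinearMap.funLeft ℚ ℚ Subtype.val
  have hCH := internalFaces_mono (faceComponents_subset hC)
  rw [incidenceRank, Matrix.rank_eq_finrank_span_cols]
  refine le_trans ?_ ((finrank_span_finset_le_card (R := ℚ)
    ((internalFaces C ∩ S).image fun f => ρ (incidenceColumn o f))).trans Finset.card_image_le)
  refine Submodule.finrank_mono (Submodule.span_le.2 ?_)
  rintro _ ⟨f, rfl⟩
  change ρ (incidenceColumn o f.1) ∈ _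
  have h1 := Submodule.mem_map_of_mem (f := ρ) (hS ⟨f.1, hCH f.2, rfl⟩)
  rw [Submodule.map_span] at h1
  refine Submodule.span_le.2 ?_ h1
  rintro _ ⟨_, ⟨f', hf', rfl⟩, rfl⟩
  rw [Finset.mem_coe, Finset.mem_inter] at hf'
  by_cases h : f' ∈ internalFaces C
  · exact Submodule.subset_span (Finset.mem_coe.2 (Finset.mem_image_of_mem _
      (Finset.mem_inter.2 ⟨h, hf'.1⟩)))
  · have h0 : ρ (incidenceColumn o f') = 0 := by
      ext e
      change ((incidence o e.1 f' : ℤ) : ℚ) = 0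
      rw [incidence_eq_zero fun he => h (mem_internalFaces_component hC e.2 hf'.2 he)]
      simp
    rw [h0]
    exact zero_mem _

open Classical in
-- These are the faces that will pay the uniform bound. They are distributed over the components,
-- and in each one the rank bound shows that `S` has removed enough faces.
theorem card_internalFaces_sdiff_le (o : Γ.Orientation) (H : Finset Γ.Line) {S : Finset Γ.Face}
    (hS : incidenceColumn o '' (internalFaces H : Set Γ.Face) ⊆
      Submodule.span ℚ (incidenceColumn o '' (S ∩ internalFaces H : Finset Γ.Face))) :
    ((internalFaces H \ S).card : ℤ) ≤ ∑ C ∈ faceComponents H,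
      (((internalFaces C).card : ℤ) - (incidenceRank o C : ℤ)) := by
  have h1 : internalFaces H \ S ⊆ (faceComponents H).biUnion fun C => internalFaces C \ S := by
    intro f hf
    obtain ⟨C, hC, hfC⟩ := exists_component_of_mem_internalFaces (Finset.mem_sdiff.1 hf).1
    exact Finset.mem_biUnion.2 ⟨C, hC, Finset.mem_sdiff.2 ⟨hfC, (Finset.mem_sdiff.1 hf).2⟩⟩
  have h2 := (Finset.card_le_card h1).trans Finset.card_biUnion_le
  calc ((internalFaces H \ S).card : ℤ)
      ≤ ∑ C ∈ faceComponents H, ((internalFaces C \ S).card : ℤ) := by exact_mod_cast h2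
    _ ≤ _ := by
      refine Finset.sum_le_sum fun C hC => ?_
      have h3 := Finset.card_sdiff_add_card_inter (internalFaces C) S
      have h4 := incidenceRank_component_le hC hS
      omega

open Classical in
/-- The power-counting factor dominates the naive bound in which the faces of an adapted
family `S` have been integrated out. -/
theorem le_powerCounting (D : ℕ) (o : Γ.Orientation) {M : ℝ} (hM : 1 < M) (μ : Γ.Line → ℕ)
    {S : Finset Γ.Face}
    (hS : ∀ i, incidenceColumn o '' (internalFaces (linesAbove μ i) : Set Γ.Face) ⊆
      Submodule.span ℚ (incidenceColumn o ''
        (S ∩ internalFaces (linesAbove μ i) : Finset Γ.Face))) :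
    (∏ e, (M ^ (2 * (μ e + 1)))⁻¹) *
      (∏ f ∈ (Finset.univ.filter fun f : Γ.Face => f.Closed) \ S, (M ^ f.scale μ) ^ D) ≤
        powerCounting D o M μ := by
  have hM0 : 0 < M := by linarith
  -- From `N` on, no line survives, and the product over the empty set of components is one.
  set N := ∑ e, μ e + 1 with hN
  have hμN (e : Γ.Line) : μ e < N :=
    Nat.lt_succ_of_le (Finset.single_le_sum (f := μ) (fun _ _ => Nat.zero_le _) (Finset.mem_univ e))
  have hempty (i : ℕ) (hi : N ≤ i) : linesAbove μ i = ∅ := by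
    refine Finset.filter_eq_empty_iff.2 fun e _ => ?_
    have := hμN e
    omega
  have hprod : powerCounting D o M μ =
      ∏ i ∈ Finset.range N, ∏ H ∈ faceComponents (linesAbove μ i), M ^ divergenceDegree D o H := by
    refine finprod_eq_prod_of_mulSupport_subset _ fun i hi => ?_
    rw [Finset.coe_range, Set.mem_Iio]
    by_contra h
    refine hi ?_
    simp only [hempty i (by omega), faceComponents, Finset.image_empty, Finset.prod_empty]
  have hω (i : ℕ) : -2 * ((linesAbove μ i).card : ℤ) +
      (D : ℤ) * ((internalFaces (linesAbove μ i) \ S).card : ℤ) ≤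
      ∑ C ∈ faceComponents (linesAbove μ i), divergenceDegree D o C := by
    simp only [divergenceDegree]
    rw [Finset.sum_add_distrib, ← Finset.mul_sum, ← Finset.mul_sum]
    have h1 : (∑ C ∈ faceComponents (linesAbove μ i), (C.card : ℤ)) ≤ (linesAbove μ i).card := by
      exact_mod_cast sum_card_faceComponents_le _
    have h2 := mul_le_mul_of_nonneg_left (card_internalFaces_sdiff_le o _ (hS i))
      (Int.natCast_nonneg D)
    linarith
  -- A line belongs to the subgraphs of index 0 up to `μ e`, hence `μ e + 1` times; this is why the
  -- exponents on the left of the statement are shifted by one.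
  have hL : ∑ i ∈ Finset.range N, ((linesAbove μ i).card : ℤ) = ∑ e, ((μ e : ℤ) + 1) := by
    have h : ∑ i ∈ Finset.range N, (linesAbove μ i).card = ∑ e, (μ e + 1) := by
      simp only [linesAbove, Finset.card_filter]
      rw [Finset.sum_comm]
      refine Finset.sum_congr rfl fun e _ => ?_
      rw [← Finset.card_filter]
      have : (Finset.range N).filter (fun i => i ≤ μ e) = Finset.range (μ e + 1) := by
        ext i
        have := hμN e
        simp only [Finset.mem_filter, Finset.mem_range]
        omega
      rw [this, Finset.card_range]
    exact_mod_cast h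
  -- A remaining face is counted at every index up to its scale. Index 0 makes one more than the
  -- scale, and the surplus only helps since M > 1.
  have hF : ∑ f ∈ (Finset.univ.filter fun f : Γ.Face => f.Closed) \ S, (f.scale μ : ℤ) ≤
      ∑ i ∈ Finset.range N, ((internalFaces (linesAbove μ i) \ S).card : ℤ) := by
    have h : ∑ f ∈ (Finset.univ.filter fun f : Γ.Face => f.Closed) \ S, f.scale μ ≤
        ∑ i ∈ Finset.range N, (internalFaces (linesAbove μ i) \ S).card := by
      have h1 (i : ℕ) : (internalFaces (linesAbove μ i) \ S) =
          ((Finset.univ.filter fun f : Γ.Face => f.Closed) \ S).filter fun f => i ≤ f.scale μ := by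
        ext f
        simp only [Finset.mem_sdiff, mem_internalFaces_linesAbove, Finset.mem_filter,
          Finset.mem_univ, true_and]
        tauto
      simp only [h1, Finset.card_filter]
      rw [Finset.sum_comm]
      refine Finset.sum_le_sum fun f _ => ?_
      rw [← Finset.card_filter]
      have : Finset.range (f.scale μ) ⊆ (Finset.range N).filter (fun i => i ≤ f.scale μ) := by
        intro i hi
        obtain ⟨e, _, he⟩ := f.exists_scale_eq μ
        have := hμN e
        simp only [Finset.mem_filter, Finset.mem_range] at hi ⊢
        omega
      simpa using Finset.card_le_card this
    exact_mod_cast h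
  have hprod2 : powerCounting D o M μ = M ^ (∑ i ∈ Finset.range N,
      ∑ C ∈ faceComponents (linesAbove μ i), divergenceDegree D o C) := by
    rw [hprod]
    simp only [← Finset.prod_zpow_eq_zpow_sum hM0.ne']
  have hleft : (∏ e, (M ^ (2 * (μ e + 1)))⁻¹) *
      (∏ f ∈ (Finset.univ.filter fun f : Γ.Face => f.Closed) \ S, (M ^ f.scale μ) ^ D) =
      M ^ (∑ e, (-2 * ((μ e : ℤ) + 1)) +
        ∑ f ∈ (Finset.univ.filter fun f : Γ.Face => f.Closed) \ S, (D : ℤ) * (f.scale μ : ℤ)) := by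
    rw [zpow_add₀ hM0.ne', ← Finset.prod_zpow_eq_zpow_sum hM0.ne',
      ← Finset.prod_zpow_eq_zpow_sum hM0.ne']
    refine congrArg₂ (· * ·) ?_ ?_
    · refine Finset.prod_congr rfl fun e _ => ?_
      rw [← zpow_natCast, ← zpow_neg]
      congr 1
    · refine Finset.prod_congr rfl fun f _ => ?_
      rw [← pow_mul, ← zpow_natCast]
      congr 1
      push_cast
      ring
  rw [hleft, hprod2]
  refine zpow_le_zpow_right₀ hM.le ?_
  refine le_trans ?_ (Finset.sum_le_sum fun i _ => hω i)
  rw [Finset.sum_add_distrib, ← Finset.mul_sum, ← Finset.mul_sum, ← Finset.mul_sum,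
    ← Finset.mul_sum, hL]
  have := mul_le_mul_of_nonneg_left hF (Int.natCast_nonneg D)
  linarith

end FeynmanGraph

/-! ### Exact integration of independent faces. -/

section ClosedFaces

variable {E : Type*} [NormedAddCommGroup E] [InnerProductSpace ℝ E] [FiniteDimensional ℝ E]
  {G : Type*} [TopologicalSpace G] [ChartedSpace E G] [CommGroup G]
  {d : ℕ} {Γ : FeynmanGraph d}

namespace FeynmanGraph

/-- If the characters of the independent faces compensate along every line, then their
frequencies vanish. -/
theorem frequency_eq_zero_of_prod_eq_one {o : Γ.Orientation} {S : Finset Γ.Face}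
    (hS : LinearIndepOn ℚ (incidenceColumn o) (S : Set Γ.Face)) (p : S → LieCharacter E G)
    (hp : ∀ e, ∏ f : S, p f ^ incidence o e f.1 = 1) (f : S) : frequency (p f) = 0 := by
  classical
  have h1 (e : Γ.Line) : ∑ f : S, incidence o e f.1 • frequency (p f) = 0 := by
    rw [← frequency_one (E := E) (G := G), ← hp e, frequency_prod]
    simp only [frequency_zpow]
  have hli : LinearIndependent ℚ fun f : S => incidenceColumn o f.1 := hS
  -- A rational left inverse of the incidence map isolates the coordinate of `f`. Only the frequency
  -- can be inverted this way: rational coefficients act on `E` but not on the character group,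
  -- which may have torsion.
  obtain ⟨g, hg⟩ := (Finsupp.linearCombination ℚ fun f : S =>
    incidenceColumn o f.1).exists_leftInverse_of_injective (LinearMap.ker_eq_bot.2 hli)
  set φ : (Γ.Line → ℚ) →ₗ[ℚ] ℚ := Finsupp.lapply f ∘ₗ g with hφdef
  have hφ (f' : S) : ∑ e, φ (Pi.single e 1) * incidence o e f'.1 = if f' = f then 1 else 0 := by
    have h2 := LinearMap.congr_fun hg (Finsupp.single f' 1)
    simp only [LinearMap.comp_apply, Finsupp.linearCombination_single, one_smul,
      LinearMap.id_apply] at h2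
    have h3 : φ (incidenceColumn o f'.1) = if f' = f then 1 else 0 := by
      rw [hφdef, LinearMap.comp_apply, h2, Finsupp.lapply_apply, Finsupp.single_apply]
    rw [← h3, LinearMap.pi_apply_eq_sum_univ φ]
    refine Finset.sum_congr rfl fun e _ => ?_
    rw [smul_eq_mul, mul_comm, incidenceColumn]
    congr 3
    ext e'
    simp [Pi.single_apply, eq_comm]
  have h4 : ∑ e, ((φ (Pi.single e 1) : ℚ) : ℝ) •
      ∑ f' : S, incidence o e f'.1 • frequency (p f') = 0 := by
    simp only [h1, smul_zero, Finset.sum_const_zero]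
  simp only [Finset.smul_sum] at h4
  rw [Finset.sum_comm] at h4
  have h5 (f' : S) : ∑ e, ((φ (Pi.single e 1) : ℚ) : ℝ) • incidence o e f'.1 • frequency (p f') =
      (if f' = f then (1 : ℝ) else 0) • frequency (p f') := by
    rw [show (if f' = f then (1 : ℝ) else 0) = ((if f' = f then 1 else 0 : ℚ) : ℝ) by
      split_ifs <;> simp, ← hφ f']
    push_cast
    rw [Finset.sum_smul]
    refine Finset.sum_congr rfl fun e _ => ?_
    rw [mul_smul, Int.cast_smul_eq_zsmul]
  simp only [h5, ite_smul, one_smul, zero_smul, Finset.sum_ite_eq', Finset.mem_univ,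
    if_true] at h4
  exact h4

theorem continuous_holonomy [IsTopologicalGroup G] (o : Γ.Orientation) (f : Γ.Face) :
    Continuous fun h : Γ.Line → G => holonomy o h f :=
  continuous_finsetProd _ fun e _ => (continuous_apply e).zpow _

variable [LieGroup 𝓘(ℝ, E) ∞ G] [CompactSpace G] [MeasurableSpace G] [BorelSpace G]

/-- The number of characters of frequency zero, that is, of components of the group. -/
noncomputable def componentCard (E G : Type*) [NormedAddCommGroup E] [InnerProductSpace ℝ E]
    [FiniteDimensional ℝ E] [TopologicalSpace G] [ChartedSpace E G] [CommGroup G] : ℕ :=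
  Set.ncard {χ : LieCharacter E G | frequency χ = 0}

theorem finite_frequency_eq_zero (ν : Measure G) [ν.IsHaarMeasure] [IsProbabilityMeasure ν] :
    {χ : LieCharacter E G | frequency χ = 0}.Finite :=
  (finite_norm_frequency_le (E := E) ν).subset fun χ hχ => by
    rw [Set.mem_ofPred_eq] at hχ ⊢
    rw [hχ, norm_zero]
    exact zero_le_one

open Classical in
/-- The integral of a product of characters along independent faces. -/
theorem integral_prod_character_holonomy (ν : Measure G) [ν.IsHaarMeasure]
    [IsProbabilityMeasure ν] (o : Γ.Orientation) {S : Finset Γ.Face} (p : S → LieCharacter E G) :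
    ∫ h, ∏ f : S, ((p f (holonomy o h f.1) : Circle) : ℂ) ∂(Measure.pi fun _ : Γ.Line => ν) =
      if ∀ e, ∏ f : S, p f ^ incidence o e f.1 = 1 then 1 else 0 := by
  -- Exchanging the products over faces and lines leaves a single character per line variable, so
  -- the integral factorizes.
  have h1 (h : Γ.Line → G) : ∏ f : S, ((p f (holonomy o h f.1) : Circle) : ℂ) =
      ∏ e, (((∏ f : S, p f ^ incidence o e f.1) (h e) : Circle) : ℂ) := by
    refine (map_prod Circle.coeHom _ _).symm.trans (Eq.trans ?_ (map_prod Circle.coeHom _ _))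
    congr 1
    simp only [holonomy, map_prod, map_zpow, LieCharacter.prod_apply, LieCharacter.zpow_apply]
    rw [Finset.prod_comm]
  simp only [h1]
  rw [integral_fintype_prod_eq_prod (fun (e : Γ.Line) (g : G) =>
    (((∏ f : S, p f ^ incidence o e f.1) g : Circle) : ℂ))]
  simp only [integral_character]
  rw [Finset.prod_ite_zero]
  simp only [Finset.mem_univ, forall_const, Finset.prod_const_one]

/-- Integrating out the holonomies of an independent family of faces costs only the number of
components of the group per face. -/
theorem lintegral_prod_heatKernel_le (ν : Measure G) [ν.IsHaarMeasure] [IsProbabilityMeasure ν]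
    (o : Γ.Orientation) {S : Finset Γ.Face}
    (hS : LinearIndepOn ℚ (incidenceColumn o) (S : Set Γ.Face)) (β : Γ.Face → ℝ)
    (hβ : ∀ f ∈ S, 0 < β f) :
    ∫⁻ h, ∏ f ∈ S, ‖heatKernel E (β f) (holonomy o h f)‖ₑ ∂(Measure.pi fun _ : Γ.Line => ν) ≤
      ((componentCard E G ^ S.card : ℕ) : ENNReal) := by
  classical
  have := topologicalGroup_of_lieGroup 𝓘(ℝ, E) ∞ (G := G)
  have := ChartedSpace.secondCountable_of_sigmaCompact E G
  have := countable_lieCharacter (E := E) ν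
  set σ := Measure.pi fun _ : Γ.Line => ν with hσ
  set a : Γ.Face → LieCharacter E G → ℝ := fun f χ => Real.exp (-(β f * laplaceEigenvalue χ))
    with ha
  have ha0 (f χ) : 0 < a f χ := Real.exp_pos _
  set k : Finset (LieCharacter E G) → Γ.Face → G → ℂ := fun T f g =>
    ∑ χ ∈ T, (a f χ : ℂ) * ((χ g : Circle) : ℂ) with hk
  have hkc (T f) : Continuous (k T f) :=
    continuous_finsetSum _ fun χ _ => continuous_const.mul χ.continuous_coe
  have hfin := finite_frequency_eq_zero (E := E) ν
  -- Truncating the series reduces the integral to finitely many tuples of characters. The survivors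
  -- have frequency zero in every slot and weight at most one, so the bound does not depend on the
  -- truncation.
  have hpart (T : Finset (LieCharacter E G)) :
      ‖∫ h, ∏ f : S, k T f.1 (holonomy o h f.1) ∂σ‖ ≤ (componentCard E G : ℝ) ^ S.card := by
    have h1 (h : Γ.Line → G) : ∏ f : S, k T f.1 (holonomy o h f.1) =
        ∑ p ∈ Fintype.piFinset fun _ : S => T, (∏ f : S, (a f.1 (p f) : ℂ)) *
          ∏ f : S, ((p f (holonomy o h f.1) : Circle) : ℂ) := by
      simp only [hk]
      rw [Finset.prod_univ_sum]
      simp only [Finset.prod_mul_distrib]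
    simp only [h1]
    rw [integral_finsetSum]
    · simp only [integral_const_mul]
      refine (norm_sum_le _ _).trans ?_
      have h2 (p : S → LieCharacter E G) : ‖(∏ f : S, (a f.1 (p f) : ℂ)) *
          ∫ h, ∏ f : S, ((p f (holonomy o h f.1) : Circle) : ℂ) ∂σ‖ ≤
          if p ∈ Fintype.piFinset fun _ : S => hfin.toFinset then 1 else 0 := by
        rw [hσ, integral_prod_character_holonomy]
        by_cases hp : ∀ e, ∏ f : S, p f ^ incidence o e f.1 = 1
        · rw [if_pos hp, mul_one, if_pos (Fintype.mem_piFinset.2 fun f => by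
            rw [Set.Finite.mem_toFinset]
            exact frequency_eq_zero_of_prod_eq_one hS p hp f), norm_prod]
          refine Finset.prod_le_one (fun _ _ => norm_nonneg _) fun f _ => ?_
          rw [Complex.norm_real, Real.norm_of_nonneg (ha0 _ _).le]
          refine Real.exp_le_one_iff.2 (neg_nonpos.2 ?_)
          exact mul_nonneg (hβ _ f.2).le (laplaceEigenvalue_nonneg _)
        · rw [if_neg hp, mul_zero, norm_zero]
          split_ifs <;> norm_num
      refine (Finset.sum_le_sum fun p _ => h2 p).trans ?_
      rw [← Finset.sum_filter, Finset.sum_const, nsmul_one]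
      have h3 := Finset.card_le_card (show ((Fintype.piFinset fun _ : S => T).filter fun p =>
        p ∈ Fintype.piFinset fun _ : S => hfin.toFinset) ⊆
          Fintype.piFinset fun _ : S => hfin.toFinset from
            fun p hp => (Finset.mem_filter.1 hp).2)
      rw [Fintype.card_piFinset, Finset.prod_const, Finset.card_univ, Fintype.card_coe,
        ← Set.ncard_eq_toFinset_card _ hfin] at h3
      exact_mod_cast h3
    · intro p _
      refine Integrable.const_mul ?_ _
      refine Integrable.of_bound (C := 1) (Continuous.aestronglyMeasurable
        (continuous_finsetProd _ fun f _ => (p f).continuous_coe.comp (continuous_holonomy o f.1)))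
        (ae_of_all _ fun h => ?_)
      rw [norm_prod]
      exact (Finset.prod_eq_one fun f _ => Circle.norm_coe _).le
  have hlim : Filter.Tendsto (fun T => ∫ h, ∏ f : S, k T f.1 (holonomy o h f.1) ∂σ) Filter.atTop
      (nhds (∫ h, ∏ f : S, heatKernel E (β f.1) (holonomy o h f.1) ∂σ)) := by
    refine tendsto_integral_filter_of_dominated_convergence
      (fun _ => ∏ f : S, ∑' χ : LieCharacter E G, a f.1 χ)
      (Filter.Eventually.of_forall fun T => Continuous.aestronglyMeasurable
        (continuous_finsetProd _ fun f _ => (hkc T f.1).comp (continuous_holonomy o f.1)))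
      (Filter.Eventually.of_forall fun T => ae_of_all _ fun h => ?_) (integrable_const _)
      (ae_of_all _ fun h => ?_)
    · rw [norm_prod]
      refine Finset.prod_le_prod (fun _ _ => norm_nonneg _) fun f _ => ?_
      refine (norm_sum_le _ _).trans ?_
      simp only [ha, norm_heatKernel_term]
      exact (summable_exp_laplaceEigenvalue (E := E) ν (hβ _ f.2)).sum_le_tsum _
        fun χ _ => (Real.exp_pos _).le
    · exact tendsto_finsetProd _ fun f _ => (summable_heatKernel (E := E) ν (hβ _ f.2) _).hasSum
  have hmain := le_of_tendsto' hlim.norm hpart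
  have hint : Integrable (fun h => ∏ f ∈ S, ‖heatKernel E (β f) (holonomy o h f)‖) σ :=
    Continuous.integrable_of_hasCompactSupport (continuous_finsetProd _ fun f hf =>
      ((continuous_heatKernel (E := E) ν (hβ f hf)).comp (continuous_holonomy o f)).norm)
      (HasCompactSupport.of_compactSpace _)
  have hreal : ∫ h, ∏ f ∈ S, ‖heatKernel E (β f) (holonomy o h f)‖ ∂σ ≤
      (componentCard E G : ℝ) ^ S.card := by
    refine le_trans (le_of_eq ?_) hmain
    -- Positivity identifies each kernel with its norm, so the cancellations seen by the signed
    -- integral bound the absolute one.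
    have h5 : ∫ h, ∏ f : S, heatKernel E (β f.1) (holonomy o h f.1) ∂σ =
        ((∫ h, ∏ f ∈ S, ‖heatKernel E (β f) (holonomy o h f)‖ ∂σ : ℝ) : ℂ) := by
      rw [← integral_complex_ofReal]
      refine integral_congr_ae (ae_of_all _ fun h => ?_)
      simp only [Complex.ofReal_prod]
      rw [← Finset.prod_coe_sort S]
      exact Finset.prod_congr rfl fun f _ => heatKernel_eq_norm ν (hβ _ f.2) _
    rw [h5, Complex.norm_real, Real.norm_of_nonneg]
    exact integral_nonneg fun h => Finset.prod_nonneg fun _ _ => norm_nonneg _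
  have h6 := ofReal_integral_eq_lintegral_ofReal hint
    (ae_of_all _ fun h => Finset.prod_nonneg fun _ _ => norm_nonneg _)
  have h7 (h : Γ.Line → G) : ∏ f ∈ S, ‖heatKernel E (β f) (holonomy o h f)‖ₑ =
      ENNReal.ofReal (∏ f ∈ S, ‖heatKernel E (β f) (holonomy o h f)‖) := by
    rw [ENNReal.ofReal_prod_of_nonneg fun _ _ => norm_nonneg _]
    simp only [ofReal_norm]
  simp only [h7]
  rw [← h6, ← ENNReal.ofReal_natCast]
  refine ENNReal.ofReal_le_ofReal ?_
  push_cast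
  exact hreal

end FeynmanGraph

end ClosedFaces

/-! ### Integration over the Schwinger parameters. -/

section Slices

theorem measurableSet_scaleSlice (M : ℝ) (i : ℕ) : MeasurableSet (scaleSlice M i) := by
  cases i
  · exact measurableSet_Ici
  · exact measurableSet_Icc

theorem le_of_mem_scaleSlice {M : ℝ} {i : ℕ} {a : ℝ} (ha : a ∈ scaleSlice M i) :
    (M ^ (2 * i))⁻¹ ≤ a := by
  cases i with
  | zero => simpa [scaleSlice] using ha
  | succ i => exact ha.1

/-- The mass-regularized length of a slice. -/
theorem lintegral_scaleSlice_le {m M : ℝ} (hm : 0 < m) (hM : 1 < M) (i : ℕ) :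
    ∫⁻ a in scaleSlice M i, ENNReal.ofReal (Real.exp (-(m ^ 2 * a))) ≤
      ENNReal.ofReal (((m ^ 2)⁻¹ + M ^ 2) * (M ^ (2 * i))⁻¹) := by
  have hM0 : 0 < M := by linarith
  -- On the unbounded slice 0 the mass provides convergence and the constant (m²)⁻¹. On slice i + 1
  -- the exponential is at most one, and M² compensates the ratio between the upper endpoint and
  -- M^{-2(i+1)}.
  cases i with
  | zero =>
    have h1 : ∫ a in Set.Ioi (1 : ℝ), Real.exp (-(m ^ 2) * a) =
        -Real.exp (-(m ^ 2) * 1) / -(m ^ 2) :=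
      integral_exp_mul_Ioi (neg_lt_zero.2 (by positivity)) 1
    have h2 : IntegrableOn (fun a => Real.exp (-(m ^ 2) * a)) (Set.Ioi 1) :=
      integrableOn_exp_mul_Ioi (neg_lt_zero.2 (by positivity)) 1
    simp only [← neg_mul]
    rw [scaleSlice, ← restrict_Ioi_eq_restrict_Ici, ← ofReal_integral_eq_lintegral_ofReal h2
      (ae_of_all _ fun _ => (Real.exp_pos _).le), h1]
    refine ENNReal.ofReal_le_ofReal ?_
    rw [neg_div_neg_eq, mul_one]
    simp only [mul_zero, pow_zero, inv_one, mul_one]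
    have h3 : Real.exp (-(m ^ 2)) ≤ 1 := Real.exp_le_one_iff.2 (by nlinarith)
    calc Real.exp (-(m ^ 2)) / m ^ 2 ≤ 1 / m ^ 2 := by gcongr
      _ = (m ^ 2)⁻¹ := one_div _
      _ ≤ _ := by nlinarith
  | succ i =>
    calc ∫⁻ a in scaleSlice M (i + 1), ENNReal.ofReal (Real.exp (-(m ^ 2 * a)))
        ≤ ∫⁻ a in scaleSlice M (i + 1), 1 := by
          refine setLIntegral_mono measurable_const fun a ha => ?_
          rw [ENNReal.ofReal_le_one, Real.exp_le_one_iff]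
          have : 0 ≤ a := le_trans (by positivity) (le_of_mem_scaleSlice ha)
          nlinarith [mul_nonneg (sq_nonneg m) this]
      _ = volume (scaleSlice M (i + 1)) := by simp
      _ = ENNReal.ofReal ((M ^ (2 * i))⁻¹ - (M ^ (2 * (i + 1)))⁻¹) := by
          rw [scaleSlice, Real.volume_Icc]
      _ ≤ _ := by
          refine ENNReal.ofReal_le_ofReal ?_
          have h1 : M ^ 2 * (M ^ (2 * (i + 1)))⁻¹ = (M ^ (2 * i))⁻¹ := by
            rw [mul_add, mul_one, pow_add]; field_simp
          rw [add_mul, h1]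
          have h2 : 0 < (M ^ (2 * (i + 1)))⁻¹ := by positivity
          have h3 : 0 ≤ (m ^ 2)⁻¹ * (M ^ (2 * (i + 1)))⁻¹ := by positivity
          linarith

end Slices

/-! ### Tonelli's theorem for finite products. -/

namespace MeasureTheory

theorem lintegral_fin_nat_prod_eq_prod {n : ℕ} {X : Fin n → Type*}
    [∀ i, MeasurableSpace (X i)] (μ : ∀ i, Measure (X i)) [∀ i, SigmaFinite (μ i)]
    (f : ∀ i, X i → ENNReal) (hf : ∀ i, Measurable (f i)) :
    ∫⁻ x, ∏ i, f i (x i) ∂(Measure.pi μ) = ∏ i, ∫⁻ x, f i x ∂(μ i) := by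
  induction n with
  | zero => simp
  | succ n ih =>
    have hf' : Measurable fun x : ∀ i : Fin n, X i.succ => ∏ i : Fin n, f i.succ (x i) :=
      Finset.measurable_prod _ fun i _ => (hf i.succ).comp (measurable_pi_apply i)
    calc ∫⁻ x, ∏ i, f i (x i) ∂(Measure.pi μ)
        = ∫⁻ x : X 0 × ((i : Fin n) → X i.succ), f 0 x.1 * ∏ i : Fin n, f i.succ (x.2 i)
            ∂((μ 0).prod (Measure.pi fun i => μ i.succ)) := by
          rw [← ((measurePreserving_piFinSuccAbove μ 0).symm).lintegral_comp_emb
            (MeasurableEquiv.measurableEmbedding _)]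
          refine lintegral_congr fun x => ?_
          rw [Fin.prod_univ_succ]
          rfl
      _ = ∏ i, ∫⁻ x, f i x ∂(μ i) := by
          rw [lintegral_prod_mul (hf 0).aemeasurable hf'.aemeasurable,
            ih (fun i => μ i.succ) (fun i => f i.succ) fun i => hf i.succ, Fin.prod_univ_succ]

/-- **Tonelli's theorem** for a product of functions of the coordinates. -/
theorem lintegral_fintype_prod_eq_prod {ι : Type*} [Fintype ι] {X : ι → Type*}
    [∀ i, MeasurableSpace (X i)] (μ : ∀ i, Measure (X i)) [∀ i, SigmaFinite (μ i)]
    (f : ∀ i, X i → ENNReal) (hf : ∀ i, Measurable (f i)) :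
    ∫⁻ x, ∏ i, f i (x i) ∂(Measure.pi μ) = ∏ i, ∫⁻ x, f i x ∂(μ i) := by
  let e := (Fintype.equivFin ι).symm
  rw [← (measurePreserving_piCongrLeft μ e).lintegral_comp_emb
    (MeasurableEquiv.measurableEmbedding _)]
  simp_rw [← e.prod_comp, MeasurableEquiv.coe_piCongrLeft, Equiv.piCongrLeft_apply_apply]
  exact lintegral_fin_nat_prod_eq_prod (fun i => μ (e i)) (fun i => f (e i)) fun i => hf (e i)

end MeasureTheory

theorem enorm_finset_prod {ι 𝕜 : Type*} [NormedField 𝕜] (s : Finset ι) (f : ι → 𝕜) :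
    ‖∏ i ∈ s, f i‖ₑ = ∏ i ∈ s, ‖f i‖ₑ := by
  simp only [← ofReal_norm, norm_prod]
  exact ENNReal.ofReal_prod_of_nonneg fun _ _ => norm_nonneg _

/-! ### Power counting of the amputated integrand. -/

section ClosedFaceBound

variable {E : Type*} [NormedAddCommGroup E] [InnerProductSpace ℝ E] [FiniteDimensional ℝ E]
  {G : Type*} [TopologicalSpace G] [ChartedSpace E G] [CommGroup G]
  [LieGroup 𝓘(ℝ, E) ∞ G] [CompactSpace G] [MeasurableSpace G] [BorelSpace G]
  {d : ℕ} {Γ : FeynmanGraph d}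

variable (E) in
/-- The heat kernel, extended by zero to non-positive times. -/
noncomputable def positiveTimeHeatKernel (p : ℝ × G) : ℂ :=
  open Classical in if 0 < p.1 then heatKernel E p.1 p.2 else 0

theorem positiveTimeHeatKernel_of_pos {α : ℝ} (hα : 0 < α) (g : G) :
    positiveTimeHeatKernel E (α, g) = heatKernel E α g :=
  if_pos hα

/-- The series is controlled only at positive times. Cutting it off elsewhere gives a globally
measurable kernel, as Tonelli's theorem requires, with no change on the slices. -/
theorem measurable_positiveTimeHeatKernel (ν : Measure G) [ν.IsHaarMeasure]
    [IsProbabilityMeasure ν] : Measurable (positiveTimeHeatKernel E : ℝ × G → ℂ) := by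
  classical
  have := ChartedSpace.secondCountable_of_sigmaCompact E G
  have h := ContinuousOn.measurable_piecewise (f := fun p : ℝ × G => heatKernel E p.1 p.2)
    (g := fun _ => 0) (s := Set.Ioi 0 ×ˢ Set.univ) (continuousOn_heatKernel ν)
    continuousOn_const (isOpen_Ioi.prod isOpen_univ).measurableSet
  convert h using 1
  ext p
  simp [positiveTimeHeatKernel, Set.piecewise]

namespace FeynmanGraph

theorem faceParameter_pos {α : Γ.Line → ℝ} (hα : ∀ e, 0 < α e) (f : Γ.Face) :
    0 < faceParameter α f := by
  classical
  obtain ⟨e, he⟩ := f.exists_through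
  exact Finset.sum_pos (fun e _ => hα e) ⟨e, Finset.mem_filter.2 ⟨Finset.mem_univ _, he⟩⟩

theorem pos_of_mem_slices {M : ℝ} (hM : 1 < M) {μ : Γ.Line → ℕ} {α : Γ.Line → ℝ}
    (hα : ∀ e, α e ∈ scaleSlice M (μ e)) (e : Γ.Line) : 0 < α e :=
  have : 0 < M := by linarith
  lt_of_lt_of_le (by positivity) (le_of_mem_scaleSlice (hα e))

/-- The line of lowest scale carries the largest Schwinger parameter up to constants, and it alone
gives the bound. -/
theorem le_faceParameter {M : ℝ} (hM : 1 < M) {μ : Γ.Line → ℕ} {α : Γ.Line → ℝ}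
    (hα : ∀ e, α e ∈ scaleSlice M (μ e)) (f : Γ.Face) :
    (M ^ (2 * f.scale μ))⁻¹ ≤ faceParameter α f := by
  classical
  obtain ⟨e, he, hes⟩ := f.exists_scale_eq μ
  rw [← hes]
  exact (le_of_mem_scaleSlice (hα e)).trans (Finset.single_le_sum (f := α)
    (fun e _ => (pos_of_mem_slices hM hα e).le) (Finset.mem_filter.2 ⟨Finset.mem_univ _, he⟩))

theorem measurable_faceParameter (f : Γ.Face) :
    Measurable fun α : Γ.Line → ℝ => faceParameter α f :=
  Finset.measurable_sum _ fun e _ => measurable_pi_apply e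

theorem measurable_holonomy [IsTopologicalGroup G] [SecondCountableTopology G]
    (o : Γ.Orientation) (f : Γ.Face) : Measurable fun h : Γ.Line → G => holonomy o h f :=
  (continuous_holonomy o f).measurable

variable (E) in
/-- The amputated integrand with the heat kernels extended by zero. -/
noncomputable def truncatedAmputatedIntegrand (o : Γ.Orientation) (m : ℝ)
    (x : (Γ.Line → ℝ) × (Γ.Line → G)) : ℂ :=
  (∏ e, (Real.exp (-(m ^ 2 * x.1 e)) : ℂ)) *
    ∏ f : Γ.ClosedFace, positiveTimeHeatKernel E (faceParameter x.1 f.1, holonomy o x.2 f.1)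

variable (E) in
/-- The product of the open faces, with the heat kernels extended by zero. -/
noncomputable def truncatedOpenFaces (o : Γ.Orientation)
    (y : (Γ.OpenFace → G × G) × ((Γ.Line → ℝ) × (Γ.Line → G))) : ℂ :=
  ∏ f : Γ.OpenFace, positiveTimeHeatKernel E
    (faceParameter y.2.1 f.1, (y.1 f).1 * holonomy o y.2.2 f.1 * (y.1 f).2⁻¹)

theorem truncatedAmputatedIntegrand_eq {o : Γ.Orientation} {m : ℝ}
    {x : (Γ.Line → ℝ) × (Γ.Line → G)} (hx : ∀ e, 0 < x.1 e) :
    truncatedAmputatedIntegrand E o m x = amputatedIntegrand E o m x := by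
  simp only [truncatedAmputatedIntegrand, amputatedIntegrand,
    positiveTimeHeatKernel_of_pos (faceParameter_pos hx _)]

theorem truncatedIntegrand_eq {o : Γ.Orientation} {m : ℝ} {b : Γ.OpenFace → G × G}
    {x : (Γ.Line → ℝ) × (Γ.Line → G)} (hx : ∀ e, 0 < x.1 e) :
    truncatedAmputatedIntegrand E o m x * truncatedOpenFaces E o (b, x) =
      integrand E o m b x := by
  simp only [truncatedAmputatedIntegrand_eq hx, truncatedOpenFaces, integrand,
    positiveTimeHeatKernel_of_pos (faceParameter_pos hx _)]

theorem measurable_truncatedAmputatedIntegrand (ν : Measure G) [ν.IsHaarMeasure]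
    [IsProbabilityMeasure ν] (o : Γ.Orientation) (m : ℝ) :
    Measurable (truncatedAmputatedIntegrand (G := G) E o m) := by
  have := topologicalGroup_of_lieGroup 𝓘(ℝ, E) ∞ (G := G)
  have := ChartedSpace.secondCountable_of_sigmaCompact E G
  refine Measurable.mul (Finset.measurable_prod _ fun e _ => ?_)
    (Finset.measurable_prod _ fun f _ => ?_)
  · exact Complex.measurable_ofReal.comp (Real.measurable_exp.comp
      (((measurable_pi_apply e).comp measurable_fst).const_mul _).neg)
  · exact (measurable_positiveTimeHeatKernel ν).comp
      (((measurable_faceParameter f.1).comp measurable_fst).prodMk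
        ((measurable_holonomy o f.1).comp measurable_snd))

theorem measurable_truncatedOpenFaces (ν : Measure G) [ν.IsHaarMeasure]
    [IsProbabilityMeasure ν] (o : Γ.Orientation) :
    Measurable (truncatedOpenFaces (G := G) E o) := by
  have := topologicalGroup_of_lieGroup 𝓘(ℝ, E) ∞ (G := G)
  have := ChartedSpace.secondCountable_of_sigmaCompact E G
  refine Finset.measurable_prod _ fun f _ => (measurable_positiveTimeHeatKernel ν).comp
      (((measurable_faceParameter f.1).comp (measurable_fst.comp measurable_snd)).prodMk ?_)
  have h1 : Measurable fun y : (Γ.OpenFace → G × G) × ((Γ.Line → ℝ) × (Γ.Line → G)) => y.1 f :=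
    (measurable_pi_apply f).comp measurable_fst
  exact ((measurable_fst.comp h1).mul ((measurable_holonomy o f.1).comp
    (measurable_snd.comp measurable_snd))).mul (measurable_snd.comp h1).inv

theorem ae_mem_slices (M : ℝ) (μ : Γ.Line → ℕ) :
    ∀ᵐ α ∂(Measure.pi fun e => (volume : Measure ℝ).restrict (scaleSlice M (μ e))),
      ∀ e, α e ∈ scaleSlice M (μ e) := by
  rw [← Measure.restrict_pi_pi]
  filter_upwards [ae_restrict_mem (MeasurableSet.univ_pi fun e =>
    measurableSet_scaleSlice M (μ e))] with α hα e
  exact hα e (Set.mem_univ _)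

theorem ae_slicedMeasure (ν : Measure G) [IsProbabilityMeasure ν] (M : ℝ)
    (μ : Γ.Line → ℕ) : ∀ᵐ x ∂(slicedMeasure ν M μ), ∀ e, x.1 e ∈ scaleSlice M (μ e) :=
  Measure.quasiMeasurePreserving_fst.ae (ae_mem_slices M μ)

/-- The faces left out of a family, and those integrated out, in the closed-face product. -/
theorem lintegral_closedFaces_le (ν : Measure G) [ν.IsHaarMeasure] [IsProbabilityMeasure ν]
    {C M : ℝ} (hM : 1 < M)
    (hC : ∀ (i : ℕ) (α : ℝ), (M ^ (2 * i))⁻¹ ≤ α →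
      ∀ g : G, ‖heatKernel E α g‖ ≤ C * (M ^ i) ^ Module.finrank ℝ E)
    (o : Γ.Orientation) (μ : Γ.Line → ℕ) {A S : Finset Γ.Face} 
    (hS : LinearIndepOn ℚ (incidenceColumn o) (S : Set Γ.Face)) {α : Γ.Line → ℝ}
    (hα : ∀ e, α e ∈ scaleSlice M (μ e)) :
    ∫⁻ h, (∏ f ∈ A, ‖heatKernel E (faceParameter α f) (holonomy o h f)‖ₑ) *
      (∏ f ∈ S, ‖heatKernel E (faceParameter α f) (holonomy o h f)‖ₑ)
        ∂(Measure.pi fun _ : Γ.Line => ν) ≤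
      (∏ f ∈ A, ENNReal.ofReal (C * (M ^ f.scale μ) ^ Module.finrank ℝ E)) *
        ((componentCard E G ^ S.card : ℕ) : ENNReal) := by
  calc _ ≤ ∫⁻ h, (∏ f ∈ A, ENNReal.ofReal (C * (M ^ f.scale μ) ^ Module.finrank ℝ E)) *
      (∏ f ∈ S, ‖heatKernel E (faceParameter α f) (holonomy o h f)‖ₑ)
        ∂(Measure.pi fun _ : Γ.Line => ν) := by
        refine lintegral_mono fun h => ?_
        gcongr with f _
        rw [← ofReal_norm]
        exact ENNReal.ofReal_le_ofReal (hC _ _ (le_faceParameter hM hα f) _)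
    _ = (∏ f ∈ A, ENNReal.ofReal (C * (M ^ f.scale μ) ^ Module.finrank ℝ E)) * _ :=
        lintegral_const_mul' _ _ (ENNReal.prod_ne_top fun _ _ => ENNReal.ofReal_ne_top)
    _ ≤ _ := by
        gcongr
        exact lintegral_prod_heatKernel_le ν o hS _ fun f _ =>
          faceParameter_pos (pos_of_mem_slices hM hα) f

variable (E) in
open Classical in
theorem enorm_amputatedIntegrand (o : Γ.Orientation) (m : ℝ) {S : Finset Γ.Face}
    (hS : ∀ f ∈ S, f.Closed) (x : (Γ.Line → ℝ) × (Γ.Line → G)) :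
    ‖amputatedIntegrand E o m x‖ₑ =
      (∏ e, ENNReal.ofReal (Real.exp (-(m ^ 2 * x.1 e)))) *
      ((∏ f ∈ (Finset.univ.filter fun f : Γ.Face => f.Closed) \ S,
        ‖heatKernel E (faceParameter x.1 f) (holonomy o x.2 f)‖ₑ) *
      ∏ f ∈ S, ‖heatKernel E (faceParameter x.1 f) (holonomy o x.2 f)‖ₑ) := by
  rw [Finset.prod_sdiff (fun f hf => Finset.mem_filter.2 ⟨Finset.mem_univ _, hS f hf⟩),
    amputatedIntegrand, enorm_mul, enorm_finset_prod, enorm_finset_prod]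
  congr 1
  · refine Finset.prod_congr rfl fun e _ => ?_
    rw [← ofReal_norm, Complex.norm_real, Real.norm_of_nonneg (Real.exp_pos _).le]
  · exact (Finset.prod_subtype _ (fun f => by simp) fun f : Γ.Face =>
      ‖heatKernel E (faceParameter x.1 f) (holonomy o x.2 f)‖ₑ).symm

variable (E) in
open Classical in
/-- Abelian power counting for the absolute value of the amputated integrand. -/
theorem exists_lintegral_amputatedIntegrand_le (ν : Measure G) [ν.IsHaarMeasure]
    [IsProbabilityMeasure ν] (d : ℕ) {m M : ℝ} (hm : 0 < m) (hM : 1 < M) :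
    ∃ K : ℝ, 0 < K ∧ ∀ (Γ : FeynmanGraph d) (o : Γ.Orientation) (μ : Γ.Line → ℕ),
      ∫⁻ x, ‖amputatedIntegrand E o m x‖ₑ ∂(slicedMeasure ν M μ) ≤
        ENNReal.ofReal (K ^ Fintype.card Γ.Line *
          powerCounting (Module.finrank ℝ E) o M μ) := by
  obtain ⟨C, hC1, hC⟩ := exists_norm_heatKernel_le (E := E) ν
  have hM0 : 0 < M := by linarith
  set D := Module.finrank ℝ E
  set T := componentCard E G with hT
  have hT1 : 1 ≤ T :=
    (Set.ncard_pos (finite_frequency_eq_zero (E := E) ν)).2 ⟨1, frequency_one⟩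
  have hT1' : (1 : ℝ) ≤ T := by exact_mod_cast hT1
  set C₁ := (m ^ 2)⁻¹ + M ^ 2 with hC₁
  have hC₁0 : 0 < C₁ := by positivity
  have hCT : 1 ≤ C * T := one_le_mul_of_one_le_of_one_le hC1 hT1'
  -- Per line: `C₁` from its slice, `M ^ 2` from the shift of exponents in `le_powerCounting`, and
  -- `C * T` for each of at most d faces, whether bounded uniformly (`C`) or integrated out (`T`).
  refine ⟨C₁ * M ^ 2 * (C * T) ^ d, by positivity, fun Γ o μ => ?_⟩
  -- The filtration consists of the internal faces of the subgraphs of scale at least i, so one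
  -- family `S` serves every node of the scale tree.
  obtain ⟨S₀, hS₀, hli, hspan⟩ := exists_linearIndepOn_adapted (K := ℚ) (incidenceColumn o)
    (∑ e, μ e + 1) (fun i => (internalFaces (linesAbove μ i) : Set Γ.Face))
    (fun i j hij f hf => by
      rw [Finset.mem_coe, mem_internalFaces_linesAbove] at hf ⊢
      exact ⟨hf.1, hij.trans hf.2⟩)
    (fun n hn => by
      rw [Finset.coe_eq_empty, Finset.eq_empty_iff_forall_notMem]
      intro f hf
      rw [mem_internalFaces_linesAbove] at hf
      obtain ⟨e, _, he⟩ := f.exists_scale_eq μ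
      have := Finset.single_le_sum (f := μ) (fun _ _ => Nat.zero_le _) (Finset.mem_univ e)
      omega)
  set S := (Set.toFinite S₀).toFinset with hSdef
  have hSS₀ : (S : Set Γ.Face) = S₀ := Set.Finite.coe_toFinset _
  have hSclosed : ∀ f ∈ S, f.Closed := fun f hf =>
    (mem_internalFaces.1 (hS₀ (hSS₀ ▸ Finset.mem_coe.2 hf))).1
  have hPC := le_powerCounting D o hM μ (S := S) fun i => by
    have := hspan i
    rwa [← hSS₀, ← Finset.coe_inter] at this
  set A := (Finset.univ.filter fun f : Γ.Face => f.Closed) \ S with hAdef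
  have hcard : A.card + S.card ≤ d * Fintype.card Γ.Line := by
    rw [← Finset.card_union_of_disjoint Finset.sdiff_disjoint]
    exact (Finset.card_le_univ _).trans card_face_le
  have haesm : AEStronglyMeasurable (amputatedIntegrand (G := G) E o m) (slicedMeasure ν M μ) :=
    (measurable_truncatedAmputatedIntegrand (E := E) ν o m).aestronglyMeasurable.congr
      ((ae_slicedMeasure ν M μ).mono fun x hx =>
        truncatedAmputatedIntegrand_eq (pos_of_mem_slices hM hx))
  have hmain : ∫⁻ x, ‖amputatedIntegrand E o m x‖ₑ ∂(slicedMeasure ν M μ) ≤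
      (∏ e, ENNReal.ofReal (C₁ * (M ^ (2 * μ e))⁻¹)) *
        ((∏ f ∈ A, ENNReal.ofReal (C * (M ^ f.scale μ) ^ D)) * ((T ^ S.card : ℕ) : ENNReal)) := by
    rw [slicedMeasure] at haesm ⊢
    rw [lintegral_prod _ haesm.enorm]
    calc _ ≤ ∫⁻ α, (∏ e, ENNReal.ofReal (Real.exp (-(m ^ 2 * α e)))) *
          ((∏ f ∈ A, ENNReal.ofReal (C * (M ^ f.scale μ) ^ D)) * ((T ^ S.card : ℕ) : ENNReal))
          ∂(Measure.pi fun e => (volume : Measure ℝ).restrict (scaleSlice M (μ e))) := by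
          refine lintegral_mono_ae ((ae_mem_slices M μ).mono fun α hα => ?_)
          simp only [enorm_amputatedIntegrand E o m hSclosed]
          rw [lintegral_const_mul' _ _ (ENNReal.prod_ne_top fun _ _ => ENNReal.ofReal_ne_top)]
          gcongr
          exact lintegral_closedFaces_le ν hM (hC M hM) o μ
            (hSS₀.symm ▸ hli) hα
      _ = (∏ e, ∫⁻ a in scaleSlice M (μ e), ENNReal.ofReal (Real.exp (-(m ^ 2 * a)))) * _ := by
          rw [lintegral_mul_const' _ _ (ENNReal.mul_ne_top
            (ENNReal.prod_ne_top fun _ _ => ENNReal.ofReal_ne_top) (ENNReal.natCast_ne_top _)),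
            lintegral_fintype_prod_eq_prod _
              (fun (_ : Γ.Line) (a : ℝ) => ENNReal.ofReal (Real.exp (-(m ^ 2 * a))))
              fun e => by fun_prop]
      _ ≤ _ := by
          gcongr with e _
          exact lintegral_scaleSlice_le hm hM (μ e)
  refine hmain.trans ?_
  rw [← ENNReal.ofReal_prod_of_nonneg fun _ _ => by positivity,
    ← ENNReal.ofReal_prod_of_nonneg fun _ _ => by positivity, ← ENNReal.ofReal_natCast,
    ← ENNReal.ofReal_mul (Finset.prod_nonneg fun _ _ => by positivity),
    ← ENNReal.ofReal_mul (Finset.prod_nonneg fun _ _ => by positivity)]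
  refine ENNReal.ofReal_le_ofReal ?_
  have h1 : ∏ e, (C₁ * (M ^ (2 * μ e))⁻¹) =
      (C₁ * M ^ 2) ^ Fintype.card Γ.Line * ∏ e, (M ^ (2 * (μ e + 1)))⁻¹ := by
    rw [← Finset.card_univ, ← Finset.prod_const, ← Finset.prod_mul_distrib]
    refine Finset.prod_congr rfl fun e _ => ?_
    rw [mul_add, mul_one, pow_add]
    field_simp
  have h2 : C ^ A.card * (T : ℝ) ^ S.card ≤ ((C * T) ^ d) ^ Fintype.card Γ.Line := by
    calc C ^ A.card * (T : ℝ) ^ S.card ≤ (C * T) ^ A.card * (C * T) ^ S.card := by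
          gcongr
          · exact le_mul_of_one_le_right (by linarith) hT1'
          · exact le_mul_of_one_le_left (by linarith) hC1
      _ = (C * T) ^ (A.card + S.card) := (pow_add _ _ _).symm
      _ ≤ (C * T) ^ (d * Fintype.card Γ.Line) := pow_le_pow_right₀ hCT hcard
      _ = _ := pow_mul _ _ _
  rw [h1, Finset.prod_mul_distrib, Finset.prod_const, mul_pow (C₁ * M ^ 2)]
  push_cast
  calc _ = (C₁ * M ^ 2) ^ Fintype.card Γ.Line * (C ^ A.card * (T : ℝ) ^ S.card) *
        ((∏ e, (M ^ (2 * (μ e + 1)))⁻¹) * ∏ f ∈ A, (M ^ f.scale μ) ^ D) := by ring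
    _ ≤ _ := by
      gcongr

end FeynmanGraph

end ClosedFaceBound

/-! ### Integrating out the boundary variables. -/

section OpenFaceBound

variable {E : Type*} [NormedAddCommGroup E] [InnerProductSpace ℝ E] [FiniteDimensional ℝ E]
  {G : Type*} [TopologicalSpace G] [ChartedSpace E G] [CommGroup G]
  [LieGroup 𝓘(ℝ, E) ∞ G] [CompactSpace G] [MeasurableSpace G] [BorelSpace G]

theorem lintegral_enorm_heatKernel (ν : Measure G) [ν.IsHaarMeasure] [IsProbabilityMeasure ν]
    {α : ℝ} (hα : 0 < α) : ∫⁻ g, ‖heatKernel E α g‖ₑ ∂ν = 1 := by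
  have hint : Integrable (heatKernel E α : G → ℂ) ν :=
    (continuous_heatKernel ν hα).integrable_of_hasCompactSupport
      (HasCompactSupport.of_compactSpace _)
  rw [← ofReal_integral_norm_eq_lintegral_enorm hint, integral_norm_heatKernel ν hα,
    ENNReal.ofReal_one]

/-- Integrating over the boundary variables of an open face gives one. -/
theorem lintegral_enorm_heatKernel_boundary (ν : Measure G) [ν.IsHaarMeasure]
    [IsProbabilityMeasure ν] {α : ℝ} (hα : 0 < α) (c : G) :
    ∫⁻ p : G × G, ‖heatKernel E α (p.1 * c * p.2⁻¹)‖ₑ ∂(ν.prod ν) = 1 := by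
  have := topologicalGroup_of_lieGroup 𝓘(ℝ, E) ∞ (G := G)
  have := ChartedSpace.secondCountable_of_sigmaCompact E G
  have hK := continuous_heatKernel (E := E) ν hα
  have hm : Measurable fun p : G × G => ‖heatKernel E α (p.1 * c * p.2⁻¹)‖ₑ :=
    Continuous.measurable (by fun_prop)
  rw [lintegral_prod_symm _ hm.aemeasurable]
  have h (y : G) : ∫⁻ x, ‖heatKernel E α (x * c * y⁻¹)‖ₑ ∂ν = 1 := by
    have h1 (x : G) : x * c * y⁻¹ = (c * y⁻¹) * x := by rw [mul_assoc, mul_comm]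
    simp only [h1]
    rw [lintegral_mul_left_eq_self (fun g => ‖heatKernel E α g‖ₑ)]
    exact lintegral_enorm_heatKernel ν hα
  simp [h]

namespace FeynmanGraph

variable {d : ℕ} {Γ : FeynmanGraph d}

/-- Each open face has its own pair of boundary variables, so the integral factorizes, whatever the
line variables are. -/
theorem lintegral_truncatedOpenFaces (ν : Measure G) [ν.IsHaarMeasure] [IsProbabilityMeasure ν]
    (o : Γ.Orientation) {x : (Γ.Line → ℝ) × (Γ.Line → G)} (hx : ∀ e, 0 < x.1 e) :
    ∫⁻ b, ‖truncatedOpenFaces E o (b, x)‖ₑ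
      ∂(Measure.pi fun _ : Γ.OpenFace => ν.prod ν) = 1 := by
  have := topologicalGroup_of_lieGroup 𝓘(ℝ, E) ∞ (G := G)
  have := ChartedSpace.secondCountable_of_sigmaCompact E G
  simp only [truncatedOpenFaces, enorm_finset_prod,
    positiveTimeHeatKernel_of_pos (faceParameter_pos hx _)]
  rw [lintegral_fintype_prod_eq_prod _ (fun (f : Γ.OpenFace) (p : G × G) =>
    ‖heatKernel E (faceParameter x.1 f.1) (p.1 * holonomy o x.2 f.1 * p.2⁻¹)‖ₑ)]
  · exact Finset.prod_eq_one fun f _ =>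
      lintegral_enorm_heatKernel_boundary ν (faceParameter_pos hx _) _
  · intro f
    have hK := continuous_heatKernel (E := E) ν (faceParameter_pos hx f.1)
    exact Continuous.measurable (by fun_prop)

theorem aestronglyMeasurable_amputatedIntegrand (ν : Measure G) [ν.IsHaarMeasure]
    [IsProbabilityMeasure ν] (o : Γ.Orientation) (m : ℝ) {M : ℝ} (hM : 1 < M)
    (μ : Γ.Line → ℕ) :
    AEStronglyMeasurable (amputatedIntegrand (G := G) E o m) (slicedMeasure ν M μ) :=
  (measurable_truncatedAmputatedIntegrand (E := E) ν o m).aestronglyMeasurable.congr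
    ((ae_slicedMeasure ν M μ).mono fun _ hx =>
      truncatedAmputatedIntegrand_eq (pos_of_mem_slices hM hx))

/-- The open faces are bounded on the slices, so they preserve integrability. -/
theorem integrable_integrand (ν : Measure G) [ν.IsHaarMeasure] [IsProbabilityMeasure ν]
    {o : Γ.Orientation} {m M : ℝ} (hM : 1 < M) {μ : Γ.Line → ℕ}
    (h : Integrable (amputatedIntegrand (G := G) E o m) (slicedMeasure ν M μ))
    (b : Γ.OpenFace → G × G) : Integrable (integrand E o m b) (slicedMeasure ν M μ) := by
  obtain ⟨C, hC1, hC⟩ := exists_norm_heatKernel_le (E := E) ν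
  have hpos := (ae_slicedMeasure ν M μ).mono fun x hx => pos_of_mem_slices hM hx
  have h1 : Integrable (fun x => truncatedAmputatedIntegrand E o m x *
      truncatedOpenFaces E o (b, x)) (slicedMeasure ν M μ) := by
    refine Integrable.mul_bdd (c := ∏ f : Γ.OpenFace,
      (C * (M ^ f.1.scale μ) ^ Module.finrank ℝ E)) (h.congr (hpos.mono fun x hx =>
        (truncatedAmputatedIntegrand_eq hx).symm))
      ((measurable_truncatedOpenFaces ν o).comp measurable_prodMk_left).aestronglyMeasurable ?_
    filter_upwards [ae_slicedMeasure ν M μ] with x hx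
    rw [truncatedOpenFaces, norm_prod]
    refine Finset.prod_le_prod (fun _ _ => norm_nonneg _) fun f _ => ?_
    rw [positiveTimeHeatKernel_of_pos (faceParameter_pos (pos_of_mem_slices hM hx) _)]
    exact hC M hM _ _ (le_faceParameter hM hx f.1) _
  exact h1.congr (hpos.mono fun x hx => truncatedIntegrand_eq hx)

theorem slicedAmplitude_eq (ν : Measure G) [IsProbabilityMeasure ν] (o : Γ.Orientation) (m : ℝ)
    {M : ℝ} (hM : 1 < M) (μ : Γ.Line → ℕ) (b : Γ.OpenFace → G × G) :
    slicedAmplitude E ν o m M μ b = ∫ x, truncatedAmputatedIntegrand E o m x *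
      truncatedOpenFaces E o (b, x) ∂(slicedMeasure ν M μ) :=
  integral_congr_ae ((ae_slicedMeasure ν M μ).mono fun _ hx =>
    (truncatedIntegrand_eq (pos_of_mem_slices hM hx)).symm)

theorem aestronglyMeasurable_slicedAmplitude (ν : Measure G) [ν.IsHaarMeasure]
    [IsProbabilityMeasure ν] (o : Γ.Orientation) (m : ℝ) {M : ℝ} (hM : 1 < M)
    (μ : Γ.Line → ℕ) : AEStronglyMeasurable (slicedAmplitude E ν o m M μ)
      (Measure.pi fun _ : Γ.OpenFace => ν.prod ν) := by
  have : SFinite (slicedMeasure ν M μ) := by rw [slicedMeasure]; infer_instance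
  have h : Measurable fun y : (Γ.OpenFace → G × G) × ((Γ.Line → ℝ) × (Γ.Line → G)) =>
      truncatedAmputatedIntegrand E o m y.2 * truncatedOpenFaces E o y :=
    ((measurable_truncatedAmputatedIntegrand ν o m).comp measurable_snd).mul
      (measurable_truncatedOpenFaces ν o)
  refine (h.stronglyMeasurable.integral_prod_right' (ν := slicedMeasure ν M μ)).aestronglyMeasurable
    |>.congr (ae_of_all _ fun b => (slicedAmplitude_eq ν o m hM μ b).symm)

/-- The boundary variables of the open faces integrate out by positivity and normalization of the
heat kernel. -/
theorem lintegral_slicedAmplitude_le (ν : Measure G) [ν.IsHaarMeasure] [IsProbabilityMeasure ν]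
    (o : Γ.Orientation) (m : ℝ) {M : ℝ} (hM : 1 < M) (μ : Γ.Line → ℕ) :
    ∫⁻ b, ‖slicedAmplitude E ν o m M μ b‖ₑ ∂(Measure.pi fun _ : Γ.OpenFace => ν.prod ν) ≤
      ∫⁻ x, ‖amputatedIntegrand E o m x‖ₑ ∂(slicedMeasure ν M μ) := by
  have : SFinite (slicedMeasure ν M μ) := by rw [slicedMeasure]; infer_instance
  have hF := (measurable_truncatedAmputatedIntegrand (E := E) ν o m).enorm
  have hO := (measurable_truncatedOpenFaces (E := E) ν o).enorm
  calc _ ≤ ∫⁻ b, ∫⁻ x, ‖truncatedAmputatedIntegrand E o m x‖ₑ * ‖truncatedOpenFaces E o (b, x)‖ₑ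
        ∂(slicedMeasure ν M μ) ∂(Measure.pi fun _ : Γ.OpenFace => ν.prod ν) := by
        refine lintegral_mono fun b => ?_
        rw [slicedAmplitude_eq ν o m hM μ b]
        refine (enorm_integral_le_lintegral_enorm _).trans_eq ?_
        simp only [enorm_mul]
    _ = ∫⁻ x, ∫⁻ b, ‖truncatedAmputatedIntegrand E o m x‖ₑ * ‖truncatedOpenFaces E o (b, x)‖ₑ
        ∂(Measure.pi fun _ : Γ.OpenFace => ν.prod ν) ∂(slicedMeasure ν M μ) :=
        lintegral_lintegral_swap ((hF.comp measurable_snd).mul hO).aemeasurable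
    _ = _ := by
        refine lintegral_congr_ae ((ae_slicedMeasure ν M μ).mono fun x hx => ?_)
        have hx' := pos_of_mem_slices hM hx
        simp only
        rw [lintegral_const_mul' _ _ enorm_ne_top,
          lintegral_truncatedOpenFaces ν o hx', mul_one, truncatedAmputatedIntegrand_eq hx']

end FeynmanGraph

end OpenFaceBound

/-! ### The power-counting bounds. -/

theorem mainTheorem4
    {E : Type*} [NormedAddCommGroup E] [InnerProductSpace ℝ E] [FiniteDimensional ℝ E]
    {G : Type*} [TopologicalSpace G] [ChartedSpace E G] [CommGroup G]
    [LieGroup 𝓘(ℝ, E) ∞ G] [CompactSpace G] [T2Space G] [MeasurableSpace G] [BorelSpace G]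
    (ν : Measure G) [ν.IsHaarMeasure] [IsProbabilityMeasure ν]
    (d : ℕ) (hd : 3 ≤ d) (m : ℝ) (hm : 0 < m) (M : ℝ) (hM : 1 < M) :
    ∃ K : ℝ, 0 < K ∧
      ∀ (Γ : FeynmanGraph d) (o : Γ.Orientation) (μ : Γ.Line → ℕ),
        (∀ b : Γ.OpenFace → G × G,
          Integrable (FeynmanGraph.integrand E o m b) (FeynmanGraph.slicedMeasure ν M μ)) ∧
        Integrable (FeynmanGraph.slicedAmplitude E ν o m M μ)
          (Measure.pi fun _ : Γ.OpenFace => ν.prod ν) ∧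
        (∫ b, ‖FeynmanGraph.slicedAmplitude E ν o m M μ b‖
            ∂(Measure.pi fun _ : Γ.OpenFace => ν.prod ν)) ≤
          K ^ Fintype.card Γ.Line *
            FeynmanGraph.powerCounting (Module.finrank ℝ E) o M μ ∧
        Integrable (FeynmanGraph.amputatedIntegrand (G := G) E o m)
          (FeynmanGraph.slicedMeasure ν M μ) ∧
        ‖FeynmanGraph.amputatedAmplitude E ν o m M μ‖ ≤
          K ^ Fintype.card Γ.Line *
            FeynmanGraph.powerCounting (Module.finrank ℝ E) o M μ := by
  obtain ⟨K, hK, h⟩ := FeynmanGraph.exists_lintegral_amputatedIntegrand_le E ν d hm hM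
  refine ⟨K, hK, fun Γ o μ => ?_⟩
  have hM0 : 0 < M := by linarith
  have hb := h Γ o μ
  set B := K ^ Fintype.card Γ.Line * FeynmanGraph.powerCounting (Module.finrank ℝ E) o M μ
  have hB : 0 ≤ B := mul_nonneg (by positivity)
    (finprod_nonneg fun i => Finset.prod_nonneg fun H _ => by positivity)
  have hamp : Integrable (FeynmanGraph.amputatedIntegrand (G := G) E o m)
      (FeynmanGraph.slicedMeasure ν M μ) :=
    ⟨FeynmanGraph.aestronglyMeasurable_amputatedIntegrand ν o m hM μ,
      hb.trans_lt ENNReal.ofReal_lt_top⟩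
  have hA := (FeynmanGraph.lintegral_slicedAmplitude_le ν o m hM μ).trans hb
  have hAint : Integrable (FeynmanGraph.slicedAmplitude E ν o m M μ)
      (Measure.pi fun _ : Γ.OpenFace => ν.prod ν) :=
    ⟨FeynmanGraph.aestronglyMeasurable_slicedAmplitude ν o m hM μ,
      hA.trans_lt ENNReal.ofReal_lt_top⟩
  refine ⟨FeynmanGraph.integrable_integrand ν hM hamp, hAint, ?_, hamp, ?_⟩
  · rw [← ENNReal.ofReal_le_ofReal_iff hB, ofReal_integral_norm_eq_lintegral_enorm hAint]
    exact hA
  · refine (norm_integral_le_integral_norm _).trans ?_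
    rw [← ENNReal.ofReal_le_ofReal_iff hB, ofReal_integral_norm_eq_lintegral_enorm hamp]
    exact hb
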